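/- \textbf{Corollary (Submultiplicativity of burden).} Let $T$ be a positive (that is, h-inductive) theory in a possibly many-sorted language $\mathcal L$, and let $\mathfrak U$ be a monster model of $T$: for a large cardinal bound $\kappa$ (with $|\mathcal L|<\kappa$, where $|\mathcal L|$ is the number of sorts and symbols plus $\aleph_0$, and $\beth_{(2^{\mu})^+}<\kappa$ for all $\mu<\kappa$), $\mathfrak U$ is a positively existentially closed model of $T$ that is positively $\kappa$-saturated and strongly $\kappa$-homogeneous (tuples of length $<\kappa$ with the same positive type are conjugate under $\operatorname{Aut}(\mathfrak U)$). ``Small'' means of cardinality $<\kappa$; ``formula'' and ``type'' mean positive formula and positive type; satisfaction and consistency are taken in $\mathfrak U$. An \emph{inp-pattern} of depth $\lambda$ (a possibly finite cardinal) in a partial type $\pi(x)$ consists of parameters $(a_{\alpha,i})_{\alpha<\lambda,\, i<\omega}$ and formulas $\phi_\alpha(x,y_\alpha)$ for $\alpha<\lambda$ such that (1) for every $\alpha<\lambda$ there are $k<\omega$ and a formula $\psi(y_0,\dots,y_{k-1})$ such that $\mathfrak U\models\neg\exists x,y_0,\dots,y_{k-1}\,\bigl(\psi(y_0,\dots,y_{k-1})\wedge\bigwedge_{i<k}\phi_\alpha(x,y_i)\bigr)$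 and $\mathfrak U\models\psi(a_{\alpha,i_0},\dots,a_{\alpha,i_{k-1}})$ for all $i_0<\dots<i_{k-1}<\omega$; and (2) for every $f\colon\lambda\to\omega$ the set $\pi(x)\cup\{\phi_\alpha(x,a_{\alpha,f(\alpha)}) : \alpha<\lambda\}$ is consistent. The \emph{burden} of $\pi$ is the supremum of the depths of the inp-patterns of small depth in $\pi$ if these depths are bounded by a small cardinal, and $\infty$ otherwise; $\operatorname{bdn}(a/E)$ denotes the burden of $\operatorname{tp}(a/E)$. Let $E\subseteq\mathfrak U$ be a small set, let $n<\omega$, let $a_0,\dots,a_{n-1}$ be small (possibly infinite) tuples from $\mathfrak U$, and let $k_0,\dots,k_{n-1}$ be natural numbers. If $\operatorname{bdn}(a_i/E)<k_i$ for every $i<n$, then \[\operatorname{bdn}(a_0,\dots,a_{n-1}/E)<\prod_{i<n}k_i .\] -/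

import Mathlib

universe u w w'

/-! Many-sorted positive logic: languages, structures, positive formulas, h-inductive theories,
positively existentially closed models, monster models, positive types, inp-patterns, burden. -/

namespace PosLogic

/-- A (possibly many-sorted) first-order language. -/
structure Lang : Type (u + 1) where
  /-- the sorts -/
  Sorts : Type u
  /-- the function symbols (constants are function symbols with empty domain) -/
  Func : Type u
  /-- the relation symbols, other than equality -/
  Rel : Type u
  /-- the list of argument sorts of a function symbol -/
  funDom : Func → List Sorts
  /-- the value sort of a function symbol -/
  funCod : Func → Sorts
  /-- the list of argument sorts of a relation symbol -/
  relDom : Rel → List Sorts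

variable {L : Lang.{u}}

/-- The cardinality of a language: the number of its sorts and symbols plus `ℵ₀`. -/
noncomputable def Lang.card (L : Lang.{u}) : Cardinal.{u} :=
  Cardinal.mk L.Sorts + Cardinal.mk L.Func + Cardinal.mk L.Rel + Cardinal.aleph0

/-! ### Terms and positive formulas -/

/-- Terms, by their sort. The free variables are indexed by `α`, and `a : α` has sort `σ a`. -/
inductive Term {α : Type w} (σ : α → L.Sorts) : L.Sorts → Type (max u w)
  | var (a : α) : Term σ (σ a)
  | app (f : L.Func) (ts : ∀ i : Fin (L.funDom f).length, Term σ ((L.funDom f).get i)) :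
      Term σ (L.funCod f)

/-- The sorts of the free variables `α` followed by those of the bound variables in scope. -/
abbrev scope {α : Type w} (σ : α → L.Sorts) (Γ : List L.Sorts) :
    α ⊕ Fin Γ.length → L.Sorts :=
  Sum.elim σ Γ.get

/-- Positive formulas: built from atomic formulas (including `⊥` and `⊤`) by `∧`, `∨`, `∃`.
The free variables are indexed by `α`, with sorts given by `σ`; the list `Γ` holds the sorts of the
bound variables in scope, the innermost one first. -/
inductive BddFormula {α : Type w} (σ : α → L.Sorts) : List L.Sorts → Type (max u w)
  | bot {Γ : List L.Sorts} : BddFormula σ Γ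
  | top {Γ : List L.Sorts} : BddFormula σ Γ
  | equal {Γ : List L.Sorts} {s : L.Sorts} (t₁ t₂ : Term (scope σ Γ) s) : BddFormula σ Γ
  | rel {Γ : List L.Sorts} (R : L.Rel)
      (ts : ∀ i : Fin (L.relDom R).length, Term (scope σ Γ) ((L.relDom R).get i)) :
      BddFormula σ Γ
  | and {Γ : List L.Sorts} (φ ψ : BddFormula σ Γ) : BddFormula σ Γ
  | or {Γ : List L.Sorts} (φ ψ : BddFormula σ Γ) : BddFormula σ Γ
  | ex {Γ : List L.Sorts} (s : L.Sorts) (φ : BddFormula σ (s :: Γ)) : BddFormula σ Γ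

/-- Positive formulas whose free variables are indexed by `α`, the variable `a` having sort `σ a`.
Here `α` may be infinite; each formula mentions only finitely many variables. -/
abbrev Formula {α : Type w} (σ : α → L.Sorts) : Type (max u w) := BddFormula σ []

/-! ### Structures and satisfaction -/

/-- Structures for a many-sorted language. -/
structure Str (L : Lang.{u}) : Type (u + 1) where
  /-- the universe of each sort -/
  carrier : L.Sorts → Type u
  /-- the interpretation of the function symbols -/
  funMap : ∀ f : L.Func, (∀ i : Fin (L.funDom f).length, carrier ((L.funDom f).get i)) →
    carrier (L.funCod f)
  /-- the interpretation of the relation symbols -/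
  relMap : ∀ R : L.Rel, (∀ i : Fin (L.relDom R).length, carrier ((L.relDom R).get i)) → Prop

/-- Tuples of elements of `M`, indexed by `α`, with sorts prescribed by `σ`. -/
abbrev Str.Tuple (M : Str L) {α : Type w} (σ : α → L.Sorts) : Type (max u w) :=
  ∀ a : α, M.carrier (σ a)

/-- The concatenation of two tuples. -/
def Str.Tuple.append {M : Str L} {α : Type w} {β : Type w'} {σ : α → L.Sorts} {τ : β → L.Sorts}
    (x : M.Tuple σ) (y : M.Tuple τ) : M.Tuple (Sum.elim σ τ)
  | Sum.inl a => x a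
  | Sum.inr b => y b

/-- The value of a term. -/
def Term.val (M : Str L) {α : Type w} {σ : α → L.Sorts} (v : M.Tuple σ) :
    ∀ {s : L.Sorts}, Term σ s → M.carrier s
  | _, .var a => v a
  | _, .app f ts => M.funMap f fun i => (ts i).val M v

/-- Satisfaction, given values `v` of the free variables and `xs` of the bound ones in scope. -/
def BddFormula.Sat (M : Str L) {α : Type w} {σ : α → L.Sorts} (v : M.Tuple σ) :
    ∀ {Γ : List L.Sorts}, BddFormula σ Γ → M.Tuple Γ.get → Prop
  | _, .bot, _ => False
  | _, .top, _ => True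
  | _, .equal t₁ t₂, xs => t₁.val M (v.append xs) = t₂.val M (v.append xs)
  | _, .rel R ts, xs => M.relMap R fun i => (ts i).val M (v.append xs)
  | _, .and φ ψ, xs => φ.Sat M v xs ∧ ψ.Sat M v xs
  | _, .or φ ψ, xs => φ.Sat M v xs ∨ ψ.Sat M v xs
  | Γ, .ex s φ, xs => ∃ x : M.carrier s,
      φ.Sat M v (Fin.cons (α := fun i => M.carrier ((s :: Γ).get i)) x xs)

/-- `M ⊨ φ(v)`. -/
def Formula.Holds (M : Str L) {α : Type w} {σ : α → L.Sorts} (φ : Formula σ) (v : M.Tuple σ) :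
    Prop :=
  BddFormula.Sat M v φ fun i => i.elim0

/-! ### Homomorphisms, h-inductive theories, pec models -/

/-- Homomorphisms of structures. -/
structure Hom (M N : Str L) : Type u where
  /-- the underlying maps, one for each sort -/
  toFun : ∀ s : L.Sorts, M.carrier s → N.carrier s
  map_fun : ∀ (f : L.Func) (x : M.Tuple (L.funDom f).get),
    toFun _ (M.funMap f x) = N.funMap f fun i => toFun _ (x i)
  map_rel : ∀ (R : L.Rel) (x : M.Tuple (L.relDom R).get),
    M.relMap R x → N.relMap R fun i => toFun _ (x i)

/-- The image of a tuple under a homomorphism. -/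
def Hom.map {M N : Str L} (f : Hom M N) {α : Type w} {σ : α → L.Sorts} (x : M.Tuple σ) :
    N.Tuple σ :=
  fun a => f.toFun _ (x a)

/-- An immersion is a homomorphism that reflects all positive formulas (it preserves them anyway). -/
def Hom.IsImmersion {M N : Str L} (f : Hom M N) : Prop :=
  ∀ (n : ℕ) (σ : Fin n → L.Sorts) (φ : Formula σ) (x : M.Tuple σ),
    φ.Holds N (f.map x) → φ.Holds M x

/-- A basic h-inductive sentence `∀ x, φ(x) → ψ(x)`, with `φ` and `ψ` positive and `x` finite. -/
structure HSentence (L : Lang.{u}) : Type u where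
  /-- the sorts of the universally quantified variables -/
  vars : List L.Sorts
  /-- the premise -/
  hyp : Formula vars.get
  /-- the conclusion -/
  concl : Formula vars.get

/-- A positive theory, that is, an h-inductive theory: a set of h-inductive sentences (an arbitrary
h-inductive sentence is a finite conjunction of basic ones). -/
abbrev Theory (L : Lang.{u}) : Type u := Set (HSentence L)

/-- `M` is a model of the positive theory `T`. -/
def Str.Models (M : Str L) (T : Theory L) : Prop :=
  ∀ χ ∈ T, ∀ x : M.Tuple χ.vars.get, χ.hyp.Holds M x → χ.concl.Holds M x

/-- `M` is a positively existentially closed (pec) model of `T`: a model of `T` such that every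
homomorphism from it to a model of `T` is an immersion. -/
def Str.IsPec (M : Str L) (T : Theory L) : Prop :=
  M.Models T ∧ ∀ N : Str L, N.Models T → ∀ f : Hom M N, f.IsImmersion

/-! ### Parameters, types, monster models -/

/-- The elements of `M`, of all sorts. -/
abbrev Str.Elem (M : Str L) : Type u := Σ s : L.Sorts, M.carrier s

/-- The tuple that enumerates a set of parameters. -/
def Str.enum (M : Str L) (E : Set M.Elem) : M.Tuple (fun e : E => e.1.1) := fun e => e.1.2

/-- Positive formulas in the variables `σ` over the parameter set `E`. -/
abbrev FormulaOver (M : Str L) (E : Set M.Elem) {α : Type w} (σ : α → L.Sorts) :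
    Type (max u w) :=
  Formula (Sum.elim σ fun e : E => e.1.1)

/-- The set of solutions of a formula over `E`. -/
def FormulaOver.solutions {M : Str L} {E : Set M.Elem} {α : Type w} {σ : α → L.Sorts}
    (φ : FormulaOver M E σ) : Set (M.Tuple σ) :=
  {x | Formula.Holds M φ (x.append (M.enum E))}

/-- A set of conditions on a tuple of variables, each given by its set of solutions in `M`, is
consistent if all finitely many of them have a common solution in `M`. -/
def Consistent {M : Str L} {α : Type w} {σ : α → L.Sorts} (S : Set (Set (M.Tuple σ))) : Prop :=
  ∀ F : Set (Set (M.Tuple σ)), F.Finite → F ⊆ S → ∃ x : M.Tuple σ, ∀ D ∈ F, x ∈ D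

/-- The positive type `tp(a/E)`. -/
def tp (M : Str L) {α : Type w} {σ : α → L.Sorts} (a : M.Tuple σ) (E : Set M.Elem) :
    Set (FormulaOver M E σ) :=
  {φ | a ∈ φ.solutions}

/-- `U` is positively `κ`-saturated: every consistent set of positive formulas in fewer than `κ`
variables over fewer than `κ` parameters is realised. -/
def Str.IsSaturated (U : Str L) (κ : Cardinal.{u}) : Prop :=
  ∀ (α : Type u) (σ : α → L.Sorts) (A : Set U.Elem) (π : Set (FormulaOver U A σ)),
    Cardinal.mk α < κ → Cardinal.mk A < κ → Consistent (FormulaOver.solutions '' π) →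
      ∃ x : U.Tuple σ, ∀ φ ∈ π, x ∈ φ.solutions

/-- `U` is strongly `κ`-homogeneous: two tuples of length less than `κ` with the same positive type
over `∅` are conjugate by an automorphism of `U`. -/
def Str.IsHomogeneous (U : Str L) (κ : Cardinal.{u}) : Prop :=
  ∀ (α : Type u) (σ : α → L.Sorts) (a b : U.Tuple σ),
    Cardinal.mk α < κ → tp U a ∅ = tp U b ∅ →
      ∃ f g : Hom U U, (∀ s x, g.toFun s (f.toFun s x) = x) ∧
        (∀ s x, f.toFun s (g.toFun s x) = x) ∧ f.map a = b

/-- `U` is a monster model of `T`, where *small* means of cardinality less than `κ`: it is a pec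
model, `κ`-saturated and strongly `κ`-homogeneous. As usual `κ` is large with respect to all small
data: it exceeds the cardinality of the language, and with `μ` also `ℶ_{(2 ^ μ)⁺}` is small. -/
structure IsMonster (T : Theory L) (κ : Cardinal.{u}) (U : Str L) : Prop where
  pec : U.IsPec T
  saturated : U.IsSaturated κ
  homogeneous : U.IsHomogeneous κ
  card_lt : L.card < κ
  beth_lt : ∀ μ < κ, Cardinal.beth (Order.succ ((2 : Cardinal.{u}) ^ μ)).ord < κ

/-! ### inp-patterns and burden -/

/-- An inp-pattern in `π(x)`, with rows indexed by `R` (so that its depth is the cardinality of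
`R`). Satisfaction and consistency are taken in `U`. -/
structure InpPattern (U : Str L) {E : Set U.Elem} {α : Type u} {σ : α → L.Sorts}
    (π : Set (FormulaOver U E σ)) (R : Type u) : Type (u + 1) where
  /-- the index set of the tuple of variables `y` used in the row `r` -/
  β : R → Type u
  /-- the sorts of these variables -/
  τ : ∀ r, β r → L.Sorts
  /-- the array of parameters -/
  a : ∀ r, ℕ → U.Tuple (τ r)
  /-- the formulas `φ_r(x, y)` -/
  φ : ∀ r, Formula (Sum.elim σ (τ r))
  /-- each row has some `k` and a formula `ψ(y₀, …, y_{k-1})` that is true on all increasing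
  `k`-tuples from the row and contradicts `⋀_{i<k} φ_r(x, y_i)` -/
  row : ∀ r, ∃ (k : ℕ) (ψ : Formula fun p : Fin k × β r => τ r p.2),
    (¬ ∃ (x : U.Tuple σ) (y : Fin k → U.Tuple (τ r)),
      ψ.Holds U (fun p => y p.1 p.2) ∧ ∀ i, (φ r).Holds U (x.append (y i))) ∧
    ∀ j : Fin k → ℕ, StrictMono j → ψ.Holds U (fun p => a r (j p.1) p.2)
  /-- every path through the rows is consistent with `π` -/
  path : ∀ f : R → ℕ, Consistent (FormulaOver.solutions '' π ∪
    Set.range fun r => {x : U.Tuple σ | (φ r).Holds U (x.append (a r (f r)))})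

/-- There is an inp-pattern of depth `μ` in `π`. -/
def HasInpPattern (U : Str L) {E : Set U.Elem} {α : Type u} {σ : α → L.Sorts}
    (π : Set (FormulaOver U E σ)) (μ : Cardinal.{u}) : Prop :=
  ∃ R : Type u, Cardinal.mk R = μ ∧ Nonempty (InpPattern U π R)

/-- The small cardinals that are depths of inp-patterns in `π`. -/
def depths (U : Str L) (κ : Cardinal.{u}) {E : Set U.Elem} {α : Type u} {σ : α → L.Sorts}
    (π : Set (FormulaOver U E σ)) : Set Cardinal.{u} :=
  {μ | μ < κ ∧ HasInpPattern U π μ}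

open Classical in
/-- The burden of `π`, computed in a monster model `U` where small means of cardinality less than
`κ`: the supremum of the depths of inp-patterns in `π` if these are bounded by a small cardinal,
and `∞` (that is, `⊤`) otherwise. -/
noncomputable def burden (U : Str L) (κ : Cardinal.{u}) {E : Set U.Elem} {α : Type u}
    {σ : α → L.Sorts} (π : Set (FormulaOver U E σ)) : WithTop Cardinal.{u} :=
  if ∃ μ < κ, ∀ ν ∈ depths U κ π, ν ≤ μ then ((sSup (depths U κ π) : Cardinal.{u}) : WithTop _)
  else ⊤

/-- `bdn(a/E)`. -/
noncomputable def bdn (U : Str L) (κ : Cardinal.{u}) {α : Type u} {σ : α → L.Sorts}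
    (a : U.Tuple σ) (E : Set U.Elem) : WithTop Cardinal.{u} :=
  burden U κ (tp U a E)

end PosLogic

/-! Deleting rows from an inp-pattern leaves an inp-pattern, so a burden is below the natural number
`k` exactly when there is no pattern of depth `k` (`bdn_lt_natCast_iff`). By induction on the number
of tuples everything rests on `hasInpPattern_append`: a pattern of depth `k * l` in tp(ab/E) yields
one of depth `k` in tp(a/E) or one of depth `l` in tp(b/E).

The given pattern is replaced by an array that is positively indiscernible over `E` in the
lexicographic order. `Selected C D` means that one `x` serves all paths through the rows of `C` at
once, with `y` depending on the path, while the rows of `D` are held at entry 0. It holds for `C`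
empty and `D` the set of all rows. Let `B` be a block of `k` rows of `D`. If some row of `B` can
join `C` once the rest of `B` is dropped, keep it. Otherwise, by compactness, for each `r` in `B`
there is a finite `N r` such that no `x` serves (an approximation of) all paths through `C` together
with entry `m` of row `r`, for every `m < N r`. These conditions on `x` form the rows of a pattern
of depth `k` in tp(a/E); its paths are consistent by `Selected` and indiscernibility
(`selected_or_hasInpPattern`). If tp(a/E) has no such pattern, then `l` blocks lead to `Selected C
∅` with `l` rows in `C`, and these rows, with `x` as a parameter, form a pattern in tp(b/E).

Negation is not available, but in a pec model the failure of a positive formula is witnessed by a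
positive formula incompatible with it (`Str.IsPec.exists_witness`). This supplies the formulas ψ
required in the rows of a pattern. It also supplies the colours in the construction of indiscernible
sequences, where a maximal realisable set of schemas is combined with a partition theorem
(`mem_of_maximal_realisable`, `exists_homogeneous`). -/

namespace PosLogic
variable {L : Lang.{u}}

/-! ### Substitution -/

/-- Substitution of terms for variables in a term. -/
def Term.subst {α : Type w} {β : Type w'} {σ : α → L.Sorts} {τ : β → L.Sorts}
    (ρ : ∀ a, Term τ (σ a)) : ∀ {s : L.Sorts}, Term σ s → Term τ s
  | _, .var a => ρ a
  | _, .app f ts => .app f fun i => (ts i).subst ρ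

theorem Term.val_subst (M : Str L) {α : Type w} {β : Type w'} {σ : α → L.Sorts}
    {τ : β → L.Sorts} (ρ : ∀ a, Term τ (σ a)) (v : M.Tuple τ) {s : L.Sorts} (t : Term σ s) :
    (t.subst ρ).val M v = t.val M fun a => (ρ a).val M v := by
  induction t with
  | var a => rfl
  | app f ts ih => simp only [Term.subst, Term.val, ih]

/-- A term seen in a scope with bound variables. -/
def Term.weaken {α : Type w} {σ : α → L.Sorts} {Γ : List L.Sorts} (s₀ : L.Sorts) {s : L.Sorts}
    (t : Term (scope σ Γ) s) : Term (scope σ (s₀ :: Γ)) s :=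
  t.subst fun
    | .inl a => .var (σ := scope σ (s₀ :: Γ)) (.inl a)
    | .inr i => .var (σ := scope σ (s₀ :: Γ)) (.inr i.succ)

theorem Term.val_weaken (M : Str L) {α : Type w} {σ : α → L.Sorts} {Γ : List L.Sorts}
    (s₀ : L.Sorts) {s : L.Sorts} (t : Term (scope σ Γ) s) (v : M.Tuple σ) (xs : M.Tuple Γ.get)
    (x : M.carrier s₀) :
    (t.weaken s₀).val M
      (v.append (τ := (s₀ :: Γ).get) (Fin.cons (α := fun i => M.carrier ((s₀ :: Γ).get i)) x xs)) =
      t.val M (v.append xs) := by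
  rw [Term.weaken, Term.val_subst]
  congr 1
  funext a
  rcases a with a | i <;> rfl

/-- A substitution, extended to the scope of one more bound variable. -/
def liftSubst {α : Type w} {β : Type w'} {σ : α → L.Sorts} {τ : β → L.Sorts}
    {Γ : List L.Sorts} {Δ : List L.Sorts}
    (ρ : ∀ a, Term (scope τ Δ) (scope σ Γ a)) (s₀ : L.Sorts) :
    ∀ a, Term (scope τ (s₀ :: Δ)) (scope σ (s₀ :: Γ) a)
  | .inl a => (ρ (.inl a)).weaken s₀
  | .inr ⟨0, _⟩ => .var (σ := scope τ (s₀ :: Δ)) (.inr ⟨0, by simp⟩)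
  | .inr ⟨i + 1, h⟩ => (ρ (.inr ⟨i, Nat.lt_of_succ_lt_succ h⟩)).weaken s₀

/-- Substitution of terms for the free and the bound variables in scope. -/
def BddFormula.subst {α : Type w} {β : Type w'} {σ : α → L.Sorts} {τ : β → L.Sorts} :
    ∀ {Γ Δ : List L.Sorts}, (∀ a, Term (scope τ Δ) (scope σ Γ a)) →
      BddFormula σ Γ → BddFormula τ Δ
  | _, _, _, .bot => .bot
  | _, _, _, .top => .top
  | _, _, ρ, .equal t₁ t₂ => .equal (t₁.subst ρ) (t₂.subst ρ)
  | _, _, ρ, .rel R ts => .rel R fun i => (ts i).subst ρ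
  | _, _, ρ, .and φ ψ => .and (φ.subst ρ) (ψ.subst ρ)
  | _, _, ρ, .or φ ψ => .or (φ.subst ρ) (ψ.subst ρ)
  | _, _, ρ, .ex s φ => .ex s (φ.subst (liftSubst ρ s))

/-- The target scope, the substitution and the values all stay general so that the induction passes
under a quantifier. -/
theorem BddFormula.sat_subst (M : Str L) {α : Type w} {β : Type w'} {σ : α → L.Sorts}
    {τ : β → L.Sorts} {Γ : List L.Sorts} (φ : BddFormula σ Γ) :
    ∀ {Δ : List L.Sorts} (ρ : ∀ a, Term (scope τ Δ) (scope σ Γ a)) (v : M.Tuple τ)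
      (ys : M.Tuple Δ.get) (x : M.Tuple σ) (xs : M.Tuple Γ.get),
      (∀ a, (ρ a).val M (v.append ys) = x.append xs a) →
      ((φ.subst ρ).Sat M v ys ↔ φ.Sat M x xs) := by
  induction φ with
  | bot => intros; rfl
  | top => intros; rfl
  | equal t₁ t₂ =>
    intro Δ ρ v ys x xs h
    have := funext h
    simp only [BddFormula.subst, BddFormula.Sat, Term.val_subst, this]
  | rel R ts =>
    intro Δ ρ v ys x xs h
    have := funext h
    simp only [BddFormula.subst, BddFormula.Sat, Term.val_subst, this]
  | and φ ψ ih₁ ih₂ =>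
    intro Δ ρ v ys x xs h
    simp only [BddFormula.subst, BddFormula.Sat, ih₁ ρ v ys x xs h, ih₂ ρ v ys x xs h]
  | or φ ψ ih₁ ih₂ =>
    intro Δ ρ v ys x xs h
    simp only [BddFormula.subst, BddFormula.Sat, ih₁ ρ v ys x xs h, ih₂ ρ v ys x xs h]
  | ex s φ ih =>
    intro Δ ρ v ys x xs h
    simp only [BddFormula.subst, BddFormula.Sat]
    refine exists_congr fun z => ih _ _ _ _ _ ?_
    rintro (a | ⟨i | i, hi⟩)
    · exact (Term.val_weaken M s _ v ys z).trans (h (.inl a))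
    · rfl
    · exact (Term.val_weaken M s _ v ys z).trans (h (.inr ⟨i, _⟩))

/-! ### Positive predicates -/

variable {M : Str L}

/-- A predicate on tuples that is defined by a positive formula. -/
def IsPos {α : Type w} {σ : α → L.Sorts} (P : M.Tuple σ → Prop) : Prop :=
  ∃ φ : Formula σ, ∀ v, φ.Holds M v ↔ P v

/-- A map between sets of tuples whose components are given by terms. -/
def IsTermMap {α : Type w} {β : Type w'} {σ : α → L.Sorts} {τ : β → L.Sorts}
    (F : M.Tuple σ → M.Tuple τ) : Prop :=
  ∀ b, ∃ t : Term σ (τ b), ∀ v, t.val M v = F v b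

section
variable {α : Type w} {β : Type w'} {σ : α → L.Sorts} {τ : β → L.Sorts}

theorem Formula.isPos (φ : Formula σ) : IsPos fun v : M.Tuple σ => φ.Holds M v := ⟨φ, fun _ => Iff.rfl⟩

theorem IsPos.congr {P Q : M.Tuple σ → Prop} (h : IsPos P) (e : ∀ v, P v ↔ Q v) : IsPos Q :=
  (funext fun v => propext (e v) : P = Q) ▸ h

theorem IsPos.true : IsPos fun _ : M.Tuple σ => True := ⟨.top, fun _ => Iff.rfl⟩

theorem IsPos.and {P Q : M.Tuple σ → Prop} : IsPos P → IsPos Q → IsPos fun v => P v ∧ Q v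
  | ⟨φ, h⟩, ⟨ψ, h'⟩ => ⟨.and φ ψ, fun v => and_congr (h v) (h' v)⟩

theorem IsPos.forall_finset {κ : Type*} (s : Finset κ) {P : κ → M.Tuple σ → Prop}
    (h : ∀ k ∈ s, IsPos (P k)) : IsPos fun v => ∀ k ∈ s, P k v := by
  classical
  induction s using Finset.induction_on with
  | empty => simpa using IsPos.true
  | insert a s _ ih =>
    simp only [Finset.mem_insert, forall_eq_or_imp] at h ⊢
    exact h.1.and (ih h.2)

theorem IsPos.forall_finite {κ : Type*} [Finite κ] {P : κ → M.Tuple σ → Prop}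
    (h : ∀ k, IsPos (P k)) : IsPos fun v => ∀ k, P k v := by
  cases nonempty_fintype κ
  simpa using IsPos.forall_finset Finset.univ fun k _ => h k

/-- The substitution of terms for the free variables of a formula. -/
def Formula.subst (ρ : ∀ a, Term τ (σ a)) (φ : Formula σ) : Formula τ :=
  BddFormula.subst (fun
    | .inl a => (ρ a).subst fun b => .var (σ := scope τ []) (.inl b)
    | .inr i => i.elim0) φ

theorem Formula.holds_subst (ρ : ∀ a, Term τ (σ a)) (φ : Formula σ) (v : M.Tuple τ) :
    (φ.subst ρ).Holds M v ↔ φ.Holds M fun a => (ρ a).val M v := by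
  refine BddFormula.sat_subst M φ _ _ _ _ _ ?_
  rintro (a | i)
  · exact Term.val_subst _ _ _ _
  · exact i.elim0

theorem IsPos.comp {P : M.Tuple τ → Prop} (h : IsPos P) {F : M.Tuple σ → M.Tuple τ}
    (hF : IsTermMap F) : IsPos fun v => P (F v) := by
  obtain ⟨φ, hφ⟩ := h
  choose ρ hρ using hF
  refine ⟨φ.subst ρ, fun v => ?_⟩
  rw [Formula.holds_subst, hφ]
  simp only [hρ]

theorem IsTermMap.var (h : β → α) :
    IsTermMap (M := M) (σ := σ) (τ := fun b => σ (h b)) fun v b => v (h b) :=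
  fun b => ⟨.var (h b), fun _ => rfl⟩

theorem IsTermMap.append {γ : Type*} {ρ : γ → L.Sorts} {F : M.Tuple σ → M.Tuple τ}
    {G : M.Tuple σ → M.Tuple ρ} (hF : IsTermMap F) (hG : IsTermMap G) :
    IsTermMap fun v => (F v).append (G v)
  | .inl b => hF b
  | .inr c => hG c

theorem IsTermMap.comp {γ : Type*} {ρ : γ → L.Sorts} {F : M.Tuple τ → M.Tuple ρ}
    {G : M.Tuple σ → M.Tuple τ} (hF : IsTermMap F) (hG : IsTermMap G) :
    IsTermMap fun v => F (G v) := fun c => by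
  obtain ⟨t, ht⟩ := hF c
  choose u hu using hG
  exact ⟨t.subst u, fun v => (Term.val_subst _ _ _ _).trans
    ((congrArg (fun w => t.val M w) (funext fun b => hu b v)).trans (ht (G v)))⟩

theorem IsPos.comp₂ {γ : Type*} {ρ : γ → L.Sorts} {P : M.Tuple τ → M.Tuple ρ → Prop}
    (h : IsPos fun v : M.Tuple (Sum.elim τ ρ) => P (fun a => v (.inl a)) fun b => v (.inr b))
    {F : M.Tuple σ → M.Tuple τ} {G : M.Tuple σ → M.Tuple ρ} (hF : IsTermMap F)
    (hG : IsTermMap G) : IsPos fun v => P (F v) (G v) :=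
  h.comp (hF.append hG)

theorem Formula.isPos_append {γ : Type*} {ρ : γ → L.Sorts} (φ : Formula (Sum.elim τ ρ))
    {F : M.Tuple σ → M.Tuple τ} {G : M.Tuple σ → M.Tuple ρ} (hF : IsTermMap F)
    (hG : IsTermMap G) : IsPos fun v => φ.Holds M ((F v).append (G v)) :=
  φ.isPos.comp (hF.append hG)

theorem IsPos.eq {s : L.Sorts} {f g : M.Tuple σ → M.carrier s}
    (hf : ∃ t : Term σ s, ∀ v, t.val M v = f v) (hg : ∃ t : Term σ s, ∀ v, t.val M v = g v) :
    IsPos fun v => f v = g v := by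
  obtain ⟨t, ht⟩ := hf
  obtain ⟨t', ht'⟩ := hg
  refine ⟨.equal (Γ := []) (t.subst fun b => .var (σ := scope σ []) (.inl b))
    (t'.subst fun b => .var (σ := scope σ []) (.inl b)), fun v => ?_⟩
  refine Iff.trans (Eq.congr ?_ ?_) (Eq.congr (ht v) (ht' v))
  · exact Term.val_subst _ _ _ _
  · exact Term.val_subst _ _ _ _

theorem IsPos.exists_one {s : L.Sorts} {P : M.Tuple σ → M.carrier s → Prop}
    (h : IsPos fun v : M.Tuple (Sum.elim σ fun _ : Unit => s) =>
      P (fun a => v (.inl a)) (v (.inr ()))) :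
    IsPos fun v => ∃ x, P v x := by
  obtain ⟨φ, hφ⟩ := h
  -- The extra free variable becomes the bound variable with index 0.
  let ρ : ∀ a, Term (scope σ [s]) (scope (Sum.elim σ fun _ : Unit => s) [] a) := fun
    | .inl (.inl a) => .var (σ := scope σ [s]) (.inl a)
    | .inl (.inr _) => .var (σ := scope σ [s]) (.inr ⟨0, by simp⟩)
    | .inr i => i.elim0
  refine ⟨.ex s (BddFormula.subst ρ φ), fun v => ?_⟩
  refine exists_congr fun x => ?_
  refine Iff.trans ?_ (hφ (v.append fun _ => x))
  refine BddFormula.sat_subst M φ _ _ _ _ _ ?_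
  rintro ((a | a) | i)
  · rfl
  · rfl
  · exact i.elim0

end

theorem IsPos.exists_fin (n : ℕ) {α : Type w} {σ : α → L.Sorts} {τ : Fin n → L.Sorts}
    {P : M.Tuple σ → M.Tuple τ → Prop}
    (h : IsPos fun v : M.Tuple (Sum.elim σ τ) => P (fun a => v (.inl a)) (fun b => v (.inr b))) :
    IsPos fun v => ∃ y, P v y := by
  induction n generalizing α with
  | zero =>
    have h' := h.comp (F := fun v : M.Tuple σ => v.append fun i => i.elim0) (by
      rintro (a | i)
      · exact ⟨.var a, fun _ => rfl⟩
      · exact i.elim0)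
    refine h'.congr fun v => ⟨fun h => ⟨_, h⟩, fun ⟨y, hy⟩ => ?_⟩
    have : y = fun i => i.elim0 := funext fun i => i.elim0
    rw [this] at hy
    exact hy
  | succ n ih =>
    have h' := h.comp (σ := Sum.elim (Sum.elim σ fun _ : Unit => τ 0) fun i : Fin n => τ i.succ)
      (F := fun v => Str.Tuple.append (fun a => v (.inl (.inl a)))
        (Fin.cons (α := fun i => M.carrier (τ i)) (v (.inl (.inr ()))) fun i => v (.inr i))) (by
      rintro (a | i)
      · exact ⟨.var (σ := Sum.elim (Sum.elim σ fun _ : Unit => τ 0) fun i : Fin n => τ i.succ)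
          (.inl (.inl a)), fun _ => rfl⟩
      · induction i using Fin.cases with
        | zero => exact ⟨.var (σ := Sum.elim (Sum.elim σ fun _ : Unit => τ 0)
            fun i : Fin n => τ i.succ) (.inl (.inr ())), fun _ => rfl⟩
        | succ i => exact ⟨.var (σ := Sum.elim (Sum.elim σ fun _ : Unit => τ 0)
            fun i : Fin n => τ i.succ) (.inr i), fun _ => rfl⟩)
    have h₁ := ih (σ := Sum.elim σ fun _ : Unit => τ 0) (τ := fun i => τ i.succ)
      (P := fun v y => P (fun a => v (.inl a))
        (Fin.cons (α := fun i => M.carrier (τ i)) (v (.inr ())) y)) h'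
    have h₂ := IsPos.exists_one (σ := σ) (s := τ 0)
      (P := fun v x => ∃ y : M.Tuple fun i : Fin n => τ i.succ,
        P v (Fin.cons (α := fun i => M.carrier (τ i)) x y)) h₁
    refine h₂.congr fun v => ⟨fun ⟨x, y, h⟩ => ⟨_, h⟩, fun ⟨y, h⟩ => ⟨y 0, fun i => y i.succ, ?_⟩⟩
    convert h
    exact Fin.cons_self_tail y

/-! ### Finite supports -/

/-- Allowing every `S'` that contains `S` makes it possible to merge the supports of several
subterms into their union. -/
theorem Term.exists_support_scope {α : Type w} {σ : α → L.Sorts} {Γ : List L.Sorts} {s : L.Sorts}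
    (t : Term (scope σ Γ) s) :
    ∃ S : Finset α, ∀ S', S ⊆ S' → ∃ t' : Term (scope (fun a : S' => σ a) Γ) s,
      ∀ (M : Str L) (v : M.Tuple σ) (xs : M.Tuple Γ.get),
        t.val M (v.append xs) = t'.val M (Str.Tuple.append (fun a : S' => v a) xs) := by
  classical
  induction t with
  | var a =>
    rcases a with a | i
    · exact ⟨{a}, fun S' h => ⟨.var (σ := scope (fun a : S' => σ a) Γ) (.inl ⟨a, h (by simp)⟩),
        fun _ _ _ => rfl⟩⟩
    · exact ⟨∅, fun S' h => ⟨.var (σ := scope (fun a : S' => σ a) Γ) (.inr i), fun _ _ _ => rfl⟩⟩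
  | app f ts ih =>
    choose S hS using ih
    refine ⟨Finset.univ.biUnion S, fun S' h => ?_⟩
    choose t' ht' using fun i => hS i S' ((Finset.subset_biUnion_of_mem S (by simp)).trans h)
    exact ⟨.app f t', fun M v xs => by simp only [Term.val, ← ht']⟩

theorem BddFormula.exists_support {α : Type w} {σ : α → L.Sorts} {Γ : List L.Sorts}
    (φ : BddFormula σ Γ) :
    ∃ S : Finset α, ∀ S', S ⊆ S' → ∃ φ' : BddFormula (fun a : S' => σ a) Γ,
      ∀ (M : Str L) (v : M.Tuple σ) (xs : M.Tuple Γ.get),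
        φ.Sat M v xs ↔ φ'.Sat M (fun a : S' => v a) xs := by
  classical
  induction φ with
  | bot => exact ⟨∅, fun _ _ => ⟨.bot, fun _ _ _ => Iff.rfl⟩⟩
  | top => exact ⟨∅, fun _ _ => ⟨.top, fun _ _ _ => Iff.rfl⟩⟩
  | equal t₁ t₂ =>
    obtain ⟨S₁, h₁⟩ := t₁.exists_support_scope
    obtain ⟨S₂, h₂⟩ := t₂.exists_support_scope
    refine ⟨S₁ ∪ S₂, fun S' h => ?_⟩
    obtain ⟨t₁', h₁⟩ := h₁ S' (Finset.union_subset_left h)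
    obtain ⟨t₂', h₂⟩ := h₂ S' (Finset.union_subset_right h)
    exact ⟨.equal t₁' t₂', fun M v xs => by simp only [BddFormula.Sat, h₁, h₂]⟩
  | rel R ts =>
    choose S hS using fun i => (ts i).exists_support_scope
    refine ⟨Finset.univ.biUnion S, fun S' h => ?_⟩
    choose t' ht' using fun i => hS i S' ((Finset.subset_biUnion_of_mem S (by simp)).trans h)
    exact ⟨.rel R t', fun M v xs => by simp only [BddFormula.Sat, ht']⟩
  | and φ₁ φ₂ ih₁ ih₂ =>
    obtain ⟨S₁, h₁⟩ := ih₁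
    obtain ⟨S₂, h₂⟩ := ih₂
    refine ⟨S₁ ∪ S₂, fun S' h => ?_⟩
    obtain ⟨t₁', h₁⟩ := h₁ S' (Finset.union_subset_left h)
    obtain ⟨t₂', h₂⟩ := h₂ S' (Finset.union_subset_right h)
    exact ⟨.and t₁' t₂', fun M v xs => by simp only [BddFormula.Sat, h₁, h₂]⟩
  | or φ₁ φ₂ ih₁ ih₂ =>
    obtain ⟨S₁, h₁⟩ := ih₁
    obtain ⟨S₂, h₂⟩ := ih₂
    refine ⟨S₁ ∪ S₂, fun S' h => ?_⟩
    obtain ⟨t₁', h₁⟩ := h₁ S' (Finset.union_subset_left h)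
    obtain ⟨t₂', h₂⟩ := h₂ S' (Finset.union_subset_right h)
    exact ⟨.or t₁' t₂', fun M v xs => by simp only [BddFormula.Sat, h₁, h₂]⟩
  | ex s φ ih =>
    obtain ⟨S, hS⟩ := ih
    refine ⟨S, fun S' h => ?_⟩
    obtain ⟨φ', h'⟩ := hS S' h
    exact ⟨.ex s φ', fun M v xs => by simp only [BddFormula.Sat, h']⟩

theorem Formula.exists_support {α : Type w} {σ : α → L.Sorts} (φ : Formula σ) :
    ∃ S : Finset α, ∀ S', S ⊆ S' → ∃ φ' : Formula (fun a : S' => σ a),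
      ∀ (M : Str L) (v : M.Tuple σ), φ.Holds M v ↔ φ'.Holds M (fun a : S' => v a) := by
  obtain ⟨S, hS⟩ := BddFormula.exists_support φ
  exact ⟨S, fun S' h => (hS S' h).imp fun φ' h' M v => h' M v _⟩

theorem IsPos.exists_support {α : Type w} {σ : α → L.Sorts} {P : M.Tuple σ → Prop}
    (h : IsPos P) : ∃ S : Finset α, ∀ S', S ⊆ S' → ∃ P' : M.Tuple (fun a : S' => σ a) → Prop,
      IsPos P' ∧ ∀ v, P v ↔ P' (fun a => v a) := by
  obtain ⟨φ, hφ⟩ := h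
  obtain ⟨S, hS⟩ := φ.exists_support
  refine ⟨S, fun S' h => ?_⟩
  obtain ⟨φ', h'⟩ := hS S' h
  exact ⟨_, φ'.isPos, fun v => by rw [← hφ, h']⟩

/-- A positive formula depends on finitely many variables. -/
theorem IsPos.exists_finset_congr {α : Type w} {σ : α → L.Sorts} {P : M.Tuple σ → Prop}
    (h : IsPos P) : ∃ S : Finset α, ∀ v v' : M.Tuple σ, (∀ a ∈ S, v a = v' a) → (P v ↔ P v') := by
  obtain ⟨S, hS⟩ := h.exists_support
  obtain ⟨P', -, hP⟩ := hS S subset_rfl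
  refine ⟨S, fun v v' h => ?_⟩
  rw [hP, hP, show (fun a : S => v a) = fun a : S => v' a from funext fun a => h a a.2]

/-- Transport of tuples along an equivalence of the index types. -/
def Str.Tuple.unindex {β : Type w} {γ : Type w'} {τ : β → L.Sorts} (e : β ≃ γ)
    (y : M.Tuple fun i => τ (e.symm i)) : M.Tuple τ :=
  fun b => cast (congrArg (fun b => M.carrier (τ b)) (e.symm_apply_apply b)) (y (e b))

theorem Str.Tuple.unindex_apply {β : Type w} {γ : Type w'} {τ : β → L.Sorts} (e : β ≃ γ)
    (y : M.Tuple fun i => τ (e.symm i)) (i : γ) : unindex e y (e.symm i) = y i := by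
  refine eq_of_heq ((cast_heq _ _).trans ?_)
  rw [e.apply_symm_apply]

theorem Str.Tuple.unindex_comp {β : Type w} {γ : Type w'} {τ : β → L.Sorts} (e : β ≃ γ)
    (y : M.Tuple τ) : unindex e (fun i => y (e.symm i)) = y := by
  funext b
  obtain ⟨i, rfl⟩ := e.symm.surjective b
  exact unindex_apply e _ i

theorem Str.Tuple.isTermMap_unindex {β : Type w} {γ : Type w'} {τ : β → L.Sorts} (e : β ≃ γ) :
    IsTermMap (M := M) (Str.Tuple.unindex (τ := τ) e) := fun b => by
  obtain ⟨i, rfl⟩ := e.symm.surjective b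
  exact ⟨.var (σ := fun i => τ (e.symm i)) i, fun v => (unindex_apply e v i).symm⟩

theorem IsPos.exists_finite {α : Type w} {β : Type w'} {σ : α → L.Sorts} {τ : β → L.Sorts}
    [Finite β] {P : M.Tuple σ → M.Tuple τ → Prop}
    (h : IsPos fun v : M.Tuple (Sum.elim σ τ) => P (fun a => v (.inl a)) (fun b => v (.inr b))) :
    IsPos fun v => ∃ y, P v y := by
  obtain ⟨n, ⟨e⟩⟩ := Finite.exists_equiv_fin β
  have h' := h.comp (σ := Sum.elim σ fun i => τ (e.symm i))
    (F := fun v => Str.Tuple.append (fun a => v (.inl a))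
      (Str.Tuple.unindex (τ := τ) e fun i => v (.inr i))) (by
    rintro (a | b)
    · exact ⟨.var (σ := Sum.elim σ fun i => τ (e.symm i)) (.inl a), fun _ => rfl⟩
    · obtain ⟨i, rfl⟩ := e.symm.surjective b
      exact ⟨.var (σ := Sum.elim σ fun i => τ (e.symm i)) (.inr i),
        fun v => (Str.Tuple.unindex_apply e (fun i => v (.inr i)) i).symm⟩)
  refine (IsPos.exists_fin n (P := fun x y => P x (Str.Tuple.unindex e y)) h').congr
    fun v => ⟨fun ⟨y, h⟩ => ⟨_, h⟩, fun ⟨y, h⟩ => ⟨fun i => y (e.symm i), ?_⟩⟩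
  rwa [Str.Tuple.unindex_comp]

/-- Positive predicates are closed under quantification over (possibly infinite) tuples. -/
theorem IsPos.exists {α : Type w} {β : Type w'} {σ : α → L.Sorts} {τ : β → L.Sorts}
    (y₀ : M.Tuple τ) {P : M.Tuple σ → M.Tuple τ → Prop}
    (h : IsPos fun v : M.Tuple (Sum.elim σ τ) => P (fun a => v (.inl a)) (fun b => v (.inr b))) :
    IsPos fun v => ∃ y, P v y := by
  classical
  obtain ⟨S, hS⟩ := h.exists_support
  obtain ⟨P', hP', e⟩ := hS S subset_rfl
  let S₂ : Finset β := S.preimage .inr Sum.inr_injective.injOn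
  let F : M.Tuple σ → M.Tuple (fun b : S₂ => τ b) →
      M.Tuple (fun a : S => Sum.elim σ τ a) := fun x y => fun
    | ⟨.inl a, _⟩ => x a
    | ⟨.inr b, hb⟩ => y ⟨b, by simpa [S₂] using hb⟩
  have h' := hP'.comp (σ := Sum.elim σ fun b : S₂ => τ b)
    (F := fun v => F (fun a => v (.inl a)) fun b => v (.inr b)) (by
    rintro ⟨a | b, h⟩
    · exact ⟨.var (σ := Sum.elim σ fun b : S₂ => τ b) (.inl a), fun _ => rfl⟩
    · exact ⟨.var (σ := Sum.elim σ fun b : S₂ => τ b) (.inr ⟨b, by simpa [S₂] using h⟩),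
        fun _ => rfl⟩)
  -- Carriers may be empty, so the coordinates outside the support are filled from `y₀`.
  refine (IsPos.exists_finite (P := fun x y => P' (F x y)) h').congr fun v => ⟨fun ⟨y, h⟩ =>
    ⟨fun b => if h : b ∈ S₂ then y ⟨b, h⟩ else y₀ b, ?_⟩, fun ⟨y, h⟩ => ⟨fun b => y b, ?_⟩⟩
  · refine (e (v.append fun b => if h : b ∈ S₂ then y ⟨b, h⟩ else y₀ b)).2 ?_
    convert h with a
    rcases a with ⟨a | b, hb⟩
    · rfl
    · exact dif_pos (by simpa [S₂] using hb)
  · convert (e (v.append y)).1 h with a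
    rcases a with ⟨a | b, hb⟩ <;> rfl

end PosLogic

namespace PosLogic
variable {L : Lang.{u}}

/-! ### Ultrapowers and positively existentially closed models -/

open Filter

/-- The ultrapower of a structure. -/
noncomputable def Str.ultrapower (M : Str L) {I : Type u} (𝒰 : Ultrafilter I) : Str L where
  carrier s := Germ (𝒰 : Filter I) (M.carrier s)
  funMap f x := ((fun i => M.funMap f fun j => Quotient.out (x j) i : I → _) : Germ _ _)
  relMap R x := ∀ᶠ i in (𝒰 : Filter I), M.relMap R fun j => Quotient.out (x j) i

section
variable {M : Str L} {I : Type u} {𝒰 : Ultrafilter I}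

/-- The tuple of the ultrapower that is given by a family of tuples. -/
def Str.Tuple.germ (𝒰 : Ultrafilter I) {α : Type w} {σ : α → L.Sorts} (v : I → M.Tuple σ) :
    (M.ultrapower 𝒰).Tuple σ :=
  fun a => ((fun i => v i a : I → M.carrier (σ a)) : Germ (𝒰 : Filter I) (M.carrier (σ a)))

theorem out_germ {X : Type u} (x : I → X) :
    (Quotient.out ((x : Germ (𝒰 : Filter I) X)) : I → X) =ᶠ[𝒰] x :=
  Germ.coe_eq.1 (Quotient.out_eq _)

/-- The representatives chosen by `Quotient.out` agree with `v` almost everywhere in each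
coordinate, hence in all of them at once because arities are finite. -/
theorem Str.ultrapower_funMap (f : L.Func) (v : I → M.Tuple (L.funDom f).get) :
    (M.ultrapower 𝒰).funMap f (Str.Tuple.germ 𝒰 v) =
      ((fun i => M.funMap f (v i) : I → _) : Germ (𝒰 : Filter I) _) := by
  refine Germ.coe_eq.2 ?_
  have h : ∀ᶠ i in (𝒰 : Filter I), ∀ j, Quotient.out (Str.Tuple.germ 𝒰 v j) i = v i j :=
    eventually_all.2 fun j => out_germ fun i => v i j
  filter_upwards [h] with i hi
  exact congrArg _ (funext hi)

theorem Str.ultrapower_relMap (R : L.Rel) (v : I → M.Tuple (L.relDom R).get) :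
    (M.ultrapower 𝒰).relMap R (Str.Tuple.germ 𝒰 v) ↔ ∀ᶠ i in (𝒰 : Filter I), M.relMap R (v i) := by
  have h : ∀ᶠ i in (𝒰 : Filter I), ∀ j, Quotient.out (Str.Tuple.germ 𝒰 v j) i = v i j :=
    eventually_all.2 fun j => out_germ fun i => v i j
  refine eventually_congr ?_
  filter_upwards [h] with i hi
  rw [← show (fun j => Quotient.out (Str.Tuple.germ 𝒰 v j) i) = v i from funext hi]

theorem Term.val_germ {α : Type w} {σ : α → L.Sorts} {s : L.Sorts} (t : Term σ s)
    (v : I → M.Tuple σ) :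
    t.val (M.ultrapower 𝒰) (Str.Tuple.germ 𝒰 v) =
      ((fun i => t.val M (v i) : I → _) : Germ (𝒰 : Filter I) _) := by
  induction t with
  | var a => rfl
  | app f ts ih =>
    simp only [Term.val, ih]
    exact Str.ultrapower_funMap f fun i j => (ts j).val M (v i)

theorem Str.Tuple.germ_append {α : Type w} {β : Type w'} {σ : α → L.Sorts} {τ : β → L.Sorts}
    (v : I → M.Tuple σ) (x : I → M.Tuple τ) :
    (Str.Tuple.germ 𝒰 v).append (Str.Tuple.germ 𝒰 x) =
      Str.Tuple.germ 𝒰 fun i => (v i).append (x i) := by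
  funext a
  rcases a with a | a <;> rfl

/-- Łoś's theorem for positive formulas. -/
theorem BddFormula.sat_germ {α : Type w} {σ : α → L.Sorts} {Γ : List L.Sorts}
    (φ : BddFormula σ Γ) (v : I → M.Tuple σ) (x : I → M.Tuple Γ.get) :
    φ.Sat (M.ultrapower 𝒰) (Str.Tuple.germ 𝒰 v) (Str.Tuple.germ 𝒰 x) ↔
      ∀ᶠ i in (𝒰 : Filter I), φ.Sat M (v i) (x i) := by
  induction φ with
  | bot => simp [BddFormula.Sat, Ultrafilter.neBot 𝒰 |>.ne]
  | top => simp [BddFormula.Sat]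
  | equal t₁ t₂ =>
    simp only [BddFormula.Sat, Str.Tuple.germ_append, Term.val_germ]
    exact Germ.coe_eq
  | rel R ts =>
    simp only [BddFormula.Sat, Str.Tuple.germ_append, Term.val_germ]
    exact Str.ultrapower_relMap R fun i j => (ts j).val M ((v i).append (x i))
  | and φ ψ ih₁ ih₂ => simp only [BddFormula.Sat, ih₁, ih₂, eventually_and]
  | or φ ψ ih₁ ih₂ => simp only [BddFormula.Sat, ih₁, ih₂, Ultrafilter.eventually_or]
  | @ex Γ s φ ih =>
    have key : ∀ z : I → M.carrier s,
        (φ.Sat (M.ultrapower 𝒰) (Str.Tuple.germ 𝒰 v) (Fin.cons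
          (α := fun i => (M.ultrapower 𝒰).carrier ((s :: Γ).get i))
          (z : Germ (𝒰 : Filter I) (M.carrier s)) (Str.Tuple.germ 𝒰 x)) ↔
        ∀ᶠ i in (𝒰 : Filter I), φ.Sat M (v i)
          (Fin.cons (α := fun i => M.carrier ((s :: Γ).get i)) (z i) (x i))) := by
      intro z
      rw [← ih]
      refine iff_of_eq (congrArg _ ?_)
      funext j
      induction j using Fin.cases <;> rfl
    simp only [BddFormula.Sat]
    constructor
    · rintro ⟨z, hz⟩
      induction z using Germ.inductionOn with | _ z =>
      filter_upwards [(key z).1 hz] with i hi using ⟨_, hi⟩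
    · intro h
      -- The carrier might be empty, so the default value for indices without a solution comes from
      -- an index that has one.
      obtain ⟨_, z₀, -⟩ := h.exists
      have hz : ∀ i, ∃ z : M.carrier s, (∃ z, φ.Sat M (v i)
          (Fin.cons (α := fun i => M.carrier ((s :: Γ).get i)) z (x i))) → φ.Sat M (v i)
          (Fin.cons (α := fun i => M.carrier ((s :: Γ).get i)) z (x i)) := fun i => by
        by_cases hi : ∃ z, φ.Sat M (v i)
          (Fin.cons (α := fun i => M.carrier ((s :: Γ).get i)) z (x i))
        · exact hi.imp fun z hz _ => hz
        · exact ⟨z₀, fun h => (hi h).elim⟩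
      choose z hz using hz
      exact ⟨_, (key z).2 (h.mono hz)⟩

theorem Formula.holds_germ {α : Type w} {σ : α → L.Sorts} (φ : Formula σ) (v : I → M.Tuple σ) :
    φ.Holds (M.ultrapower 𝒰) (Str.Tuple.germ 𝒰 v) ↔ ∀ᶠ i in (𝒰 : Filter I), φ.Holds M (v i) := by
  refine Iff.trans (iff_of_eq (congrArg
    (BddFormula.Sat (M.ultrapower 𝒰) (Str.Tuple.germ 𝒰 v) φ) (funext fun i => i.elim0)))
    (BddFormula.sat_germ φ v fun _ (i : Fin ([] : List L.Sorts).length) => i.elim0)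

theorem Str.Tuple.exists_germ {α : Type w} {σ : α → L.Sorts} (v : (M.ultrapower 𝒰).Tuple σ) :
    ∃ v' : I → M.Tuple σ, v = Str.Tuple.germ 𝒰 v' :=
  ⟨fun i a => Quotient.out (v a) i, funext fun a => (Quotient.out_eq (v a)).symm⟩

theorem Str.Models.ultrapower {T : Theory L} (h : M.Models T) (𝒰 : Ultrafilter I) :
    (M.ultrapower 𝒰).Models T := by
  intro χ hχ x hx
  obtain ⟨v, rfl⟩ := Str.Tuple.exists_germ x
  rw [Formula.holds_germ] at hx ⊢
  filter_upwards [hx] with i hi using h χ hχ _ hi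

end

/-- The tuple that lists all elements of a structure. -/
abbrev Str.all (M : Str L) : M.Tuple (fun e : M.Elem => e.1) := fun e => e.2

/-- Otherwise every positive formula true of `c` is compatible with `φ`, so the positive diagram of
`M` together with `φ` at `c` is finitely satisfiable in `M`. An ultrapower then receives a
homomorphism from `M` under which `φ` becomes true of the image of `c`. As the ultrapower is a model
of `T`, this contradicts immersion. -/
theorem Str.IsPec.exists_witness_fin {T : Theory L} {M : Str L} (hM : M.IsPec T) {n : ℕ}
    {σ : Fin n → L.Sorts} (φ : Formula σ) (c : M.Tuple σ) (hc : ¬ φ.Holds M c) :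
    ∃ ψ : Formula σ, ψ.Holds M c ∧ ∀ v : M.Tuple σ, ψ.Holds M v → ¬ φ.Holds M v := by
  classical
  by_contra! hcon
  let D := {χ : Formula (fun e : M.Elem => e.1) // χ.Holds M M.all}
  have key : ∀ i : Finset D, ∃ u : M.Tuple (fun e : M.Elem => e.1),
      (∀ χ ∈ i, χ.1.Holds M u) ∧ φ.Holds M fun j => u ⟨σ j, c j⟩ := by
    intro i
    -- Quantifying out all elements other than those of `c` turns a finite part of the diagram into
    -- a positive condition on `c`.
    have hpos : IsPos fun v : M.Tuple σ => ∃ u : M.Tuple (fun e : M.Elem => e.1),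
        (∀ χ ∈ i, χ.1.Holds M u) ∧ ∀ j, u ⟨σ j, c j⟩ = v j := by
      refine IsPos.exists M.all ?_
      refine IsPos.and (IsPos.forall_finset i fun χ _ => χ.1.isPos.comp fun e =>
        ⟨.var (σ := Sum.elim σ _) (.inr e), fun _ => rfl⟩) ?_
      exact IsPos.forall_finite fun j => IsPos.eq
        ⟨.var (σ := Sum.elim σ fun e : M.Elem => e.1) (.inr ⟨σ j, c j⟩), fun _ => rfl⟩
        ⟨.var (σ := Sum.elim σ fun e : M.Elem => e.1) (.inl j), fun _ => rfl⟩
    obtain ⟨ψ, hψ⟩ := hpos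
    obtain ⟨v, hv, hφ⟩ := hcon ψ ((hψ c).2 ⟨M.all, fun χ _ => χ.2, fun _ => rfl⟩)
    obtain ⟨u, hu, e⟩ := (hψ v).1 hv
    exact ⟨u, hu, by rwa [show (fun j => u ⟨σ j, c j⟩) = v from funext e]⟩
  choose u hu hφ using key
  -- Finer than `atTop`, so each member of the diagram holds at almost all `u i`.
  let 𝒰 : Ultrafilter (Finset D) := Ultrafilter.of atTop
  have hmem : ∀ χ : D, ∀ᶠ i in (𝒰 : Filter (Finset D)), χ.1.Holds M (u i) := by
    intro χ
    have : ∀ᶠ i in (atTop : Filter (Finset D)), χ ∈ i :=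
      (eventually_ge_atTop {χ}).mono fun i hi => hi (Finset.mem_singleton_self χ)
    exact (Filter.Eventually.filter_mono (Ultrafilter.of_le atTop) this).mono fun i hi => hu i χ hi
  let h : Hom M (M.ultrapower 𝒰) :=
    { toFun := fun s x => ((fun i => u i ⟨s, x⟩ : Finset D → _) : Germ (𝒰 : Filter (Finset D)) _)
      map_fun := by
        intro f x
        refine Eq.trans ?_ (Str.ultrapower_funMap f fun i j => u i ⟨_, x j⟩).symm
        refine Germ.coe_eq.2 ?_
        obtain ⟨χ, hχ⟩ := IsPos.eq (M := M) (σ := fun e : M.Elem => e.1)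
          (f := fun v => v ⟨_, M.funMap f x⟩) (g := fun v => M.funMap f fun j => v ⟨_, x j⟩)
          ⟨.var (σ := fun e : M.Elem => e.1) ⟨_, M.funMap f x⟩, fun _ => rfl⟩
          ⟨.app f fun j => .var (σ := fun e : M.Elem => e.1) ⟨_, x j⟩, fun _ => rfl⟩
        filter_upwards [hmem ⟨χ, (hχ _).2 rfl⟩] with i hi using (hχ _).1 hi
      map_rel := by
        intro R x hx
        refine (Str.ultrapower_relMap R fun i j => u i ⟨_, x j⟩).2 ?_
        let χ : Formula (fun e : M.Elem => e.1) := .rel R fun j =>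
          .var (σ := scope (fun e : M.Elem => e.1) []) (.inl ⟨_, x j⟩)
        filter_upwards [hmem ⟨χ, hx⟩] with i hi using hi }
  refine hc (hM.2 _ (hM.1.ultrapower 𝒰) h n σ φ c ?_)
  exact (Formula.holds_germ φ fun i j => u i ⟨σ j, c j⟩).2 (Eventually.of_forall hφ)

/-- In a pec model, the failure of a positive formula is witnessed by another positive formula. -/
theorem Str.IsPec.exists_witness {T : Theory L} {M : Str L} (hM : M.IsPec T) {α : Type w}
    {σ : α → L.Sorts} {P : M.Tuple σ → Prop} (hP : IsPos P) (c : M.Tuple σ) (hc : ¬ P c) :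
    ∃ Q : M.Tuple σ → Prop, IsPos Q ∧ Q c ∧ ∀ v, Q v → ¬ P v := by
  obtain ⟨S, hS⟩ := hP.exists_support
  obtain ⟨P', hP', e⟩ := hS S subset_rfl
  let e' := S.equivFin
  obtain ⟨φ, hφ⟩ := hP'.comp (Str.Tuple.isTermMap_unindex e')
  have hφ' : ∀ v : M.Tuple σ, φ.Holds M (fun i => v (e'.symm i)) ↔ P v := fun v => by
    rw [e, ← Str.Tuple.unindex_comp e' fun a : S => v a]
    exact hφ _
  obtain ⟨ψ, hψ, hd⟩ := hM.exists_witness_fin φ (fun i => c (e'.symm i))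
    ((hφ' c).not.2 hc)
  exact ⟨_, ψ.isPos.comp (F := fun v : M.Tuple σ => fun i => v (e'.symm i))
    fun i => ⟨.var _, fun _ => rfl⟩, hψ, fun v hv hp => hd _ hv ((hφ' v).2 hp)⟩

end PosLogic

namespace PosLogic
variable {L : Lang.{u}}

/-! ### The number of formulas -/

/-- Labels of the nodes of the trees that code terms and formulas: a symbol and an arity. -/
abbrev Label (L : Lang.{u}) (α : Type u) : Type u :=
  (L.Sorts ⊕ L.Func ⊕ L.Rel ⊕ α ⊕ ℕ) × ℕ

/-- The trees that code terms and formulas. -/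
abbrev CodeTree (L : Lang.{u}) (α : Type u) : Type u := WType fun p : Label L α => Fin p.2

/-- The tree that codes a term. -/
def Term.code {α : Type u} {β : Type w} {σ : β → L.Sorts} (v : β → α ⊕ ℕ) :
    ∀ {s : L.Sorts}, Term σ s → CodeTree L α
  | _, .var b => .mk (.inr (.inr (.inr (v b))), 0) Fin.elim0
  | _, .app f ts => .mk (.inr (.inl f), (L.funDom f).length) fun i => (ts i).code v

/-- The two sorts are not assumed equal: the head symbol in the code determines the sort, and
`equal` uses terms of different sorts. -/
theorem Term.code_injective {α : Type u} {β : Type w} {σ : β → L.Sorts} {v : β → α ⊕ ℕ}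
    (hv : v.Injective) {s : L.Sorts} (t : Term σ s) :
    ∀ {s' : L.Sorts} (t' : Term σ s'), t.code v = t'.code v →
      (⟨s, t⟩ : Σ s, Term σ s) = ⟨s', t'⟩ := by
  induction t with
  | var b =>
    rintro _ (b' | ⟨f', ts'⟩) h
    · simp only [Term.code, WType.mk.injEq, Prod.mk.injEq, Sum.inr.injEq, hv.eq_iff] at h
      obtain ⟨⟨rfl, -⟩, -⟩ := h
      rfl
    · simp [Term.code] at h
  | app f ts ih =>
    rintro _ (b' | ⟨f', ts'⟩) h
    · simp [Term.code] at h
    · simp only [Term.code, WType.mk.injEq, Prod.mk.injEq, Sum.inr.injEq, Sum.inl.injEq] at h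
      obtain ⟨⟨rfl, -⟩, h⟩ := h
      have e : ts = ts' := funext fun i => by
        have := ih i (ts' i) (congrFun (eq_of_heq h) i)
        simpa using this
      rw [e]

/-- The numbering of the variables in scope. -/
def scopeVar (α : Type u) (Γ : List L.Sorts) : α ⊕ Fin Γ.length → α ⊕ ℕ :=
  Sum.map id Fin.val

theorem scopeVar_injective (α : Type u) (Γ : List L.Sorts) : (scopeVar α Γ).Injective :=
  Function.Injective.sumMap Function.injective_id Fin.val_injective

/-- The tree that codes a formula. -/
def BddFormula.code {α : Type u} {σ : α → L.Sorts} :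
    ∀ {Γ : List L.Sorts}, BddFormula σ Γ → CodeTree L α
  | _, .bot => .mk (.inr (.inr (.inr (.inr 0))), 0) Fin.elim0
  | _, .top => .mk (.inr (.inr (.inr (.inr 1))), 0) Fin.elim0
  | _, .equal (s := s) t₁ t₂ => .mk (.inl s, 2)
      ![t₁.code (scopeVar α _), t₂.code (scopeVar α _)]
  | _, .rel R ts => .mk (.inr (.inr (.inl R)), (L.relDom R).length)
      fun i => (ts i).code (scopeVar α _)
  -- Labels are reused; the arity separates `and` from `bot`, `or` from `top`, and `ex` from
  -- `equal`.
  | _, .and φ ψ => .mk (.inr (.inr (.inr (.inr 0))), 2) ![φ.code, ψ.code]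
  | _, .or φ ψ => .mk (.inr (.inr (.inr (.inr 1))), 2) ![φ.code, ψ.code]
  | _, .ex s φ => .mk (.inl s, 1) ![φ.code]

theorem BddFormula.code_injective {α : Type u} {σ : α → L.Sorts} {Γ : List L.Sorts}
    (φ : BddFormula σ Γ) : ∀ φ' : BddFormula σ Γ, φ.code = φ'.code → φ = φ' := by
  induction φ with
  | bot => rintro (_ | _ | _ | _ | _ | _ | _) h <;> simp [BddFormula.code] at h ⊢
  | top => rintro (_ | _ | _ | _ | _ | _ | _) h <;> simp [BddFormula.code] at h ⊢
  | equal t₁ t₂ =>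
    rintro (_ | _ | ⟨t₁', t₂'⟩ | _ | _ | _ | _) h <;>
      simp only [BddFormula.code, WType.mk.injEq, Prod.mk.injEq, Sum.inl.injEq, reduceCtorEq,
        false_and, OfNat.ofNat_ne_one, and_false] at h
    obtain ⟨⟨rfl, -⟩, h⟩ := h
    have h := eq_of_heq h
    have h₁ := Term.code_injective (scopeVar_injective _ _) _ _ (congrFun h 0)
    have h₂ := Term.code_injective (scopeVar_injective _ _) _ _ (congrFun h 1)
    simp only [Sigma.mk.injEq, heq_eq_eq, true_and] at h₁ h₂
    rw [h₁, h₂]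
  | rel R ts =>
    rintro (_ | _ | _ | ⟨R', ts'⟩ | _ | _ | _) h <;>
      simp only [BddFormula.code, WType.mk.injEq, Prod.mk.injEq, Sum.inr.injEq, Sum.inl.injEq,
        reduceCtorEq, false_and] at h
    obtain ⟨⟨rfl, -⟩, h⟩ := h
    have h := eq_of_heq h
    have e : ts = ts' := funext fun i => by
      simpa using Term.code_injective (scopeVar_injective _ _) _ _ (congrFun h i)
    rw [e]
  | and φ ψ ih₁ ih₂ =>
    rintro (_ | _ | _ | _ | ⟨φ', ψ'⟩ | _ | _) h <;>
      simp only [BddFormula.code, WType.mk.injEq, Prod.mk.injEq, Sum.inr.injEq, reduceCtorEq,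
        false_and, OfNat.ofNat_ne_zero, zero_ne_one, and_false, heq_eq_eq, true_and] at h
    rw [ih₁ φ' (congrFun h 0), ih₂ ψ' (congrFun h 1)]
  | or φ ψ ih₁ ih₂ =>
    rintro (_ | _ | _ | _ | _ | ⟨φ', ψ'⟩ | _) h <;>
      simp only [BddFormula.code, WType.mk.injEq, Prod.mk.injEq, Sum.inr.injEq, reduceCtorEq,
        false_and, OfNat.ofNat_ne_zero, one_ne_zero, and_false, heq_eq_eq, true_and] at h
    rw [ih₁ φ' (congrFun h 0), ih₂ ψ' (congrFun h 1)]
  | ex s φ ih =>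
    rintro (_ | _ | _ | _ | _ | _ | ⟨s', φ'⟩) h <;>
      simp only [BddFormula.code, WType.mk.injEq, Prod.mk.injEq, Sum.inl.injEq, reduceCtorEq,
        false_and, OfNat.one_ne_ofNat, and_false] at h
    obtain ⟨⟨rfl, -⟩, h⟩ := h
    rw [ih φ' (congrFun (eq_of_heq h) 0)]

open Cardinal

/-- This bounds the number of colours when tuples are coloured by formulas. -/
theorem Formula.mk_lt {κ : Cardinal.{u}} (h : L.card < κ) {α : Type u} (hα : #α < κ)
    (σ : α → L.Sorts) : #(Formula σ) < κ := by
  have h₀ : ℵ₀ < κ := lt_of_le_of_lt (by unfold Lang.card; exact self_le_add_left _ _) h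
  have hs : #L.Sorts < κ := lt_of_le_of_lt (by
    unfold Lang.card; rw [add_assoc, add_assoc]; exact self_le_add_right _ _) h
  have hf : #L.Func < κ := lt_of_le_of_lt (by
    unfold Lang.card
    rw [add_comm #L.Sorts, add_assoc, add_assoc]; exact self_le_add_right _ _) h
  have hr : #L.Rel < κ := lt_of_le_of_lt (by
    unfold Lang.card
    rw [add_comm _ #L.Rel, add_assoc]; exact self_le_add_right _ _) h
  have hL : #(Label L α) < κ := by
    simp only [Label, mk_prod, mk_sum, mk_nat, lift_aleph0, lift_uzero, lift_id]
    refine mul_lt_of_lt h₀.le ?_ h₀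
    refine add_lt_of_lt h₀.le hs (add_lt_of_lt h₀.le hf (add_lt_of_lt h₀.le hr
      (add_lt_of_lt h₀.le hα h₀)))
  refine lt_of_le_of_lt (mk_le_of_injective (f := BddFormula.code)
    fun φ φ' h => φ.code_injective φ' h) ?_
  exact (WType.cardinalMk_le_max_aleph0_of_finite' (β := fun p : Label L α => Fin p.2)).trans_lt
    (max_lt (by simpa using hL) h₀)

theorem IsMonster.aleph0_lt {T : Theory L} {κ : Cardinal.{u}} {U : Str L} (h : IsMonster T κ U) :
    ℵ₀ < κ :=
  lt_of_le_of_lt (by unfold Lang.card; exact self_le_add_left _ _) h.card_lt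

theorem IsMonster.two_power_lt {T : Theory L} {κ : Cardinal.{u}} {U : Str L}
    (h : IsMonster T κ U) {μ : Cardinal.{u}} (hμ : μ < κ) : 2 ^ μ < κ :=
  ((Order.le_succ _).trans (le_beth_ord _)).trans_lt (h.beth_lt μ hμ)

end PosLogic

namespace PosLogic

/-! ### The Erdős–Rado theorem -/

section ErdosRado

open Cardinal

variable {I Θ : Type*} {C : Type*} [LinearOrder I] [WellFoundedLT I] [LinearOrder Θ]
  [WellFoundedLT Θ]

/-- The elements below `y` and above the initial segment of `f` below `ξ` that have the same colour
as `y` over this segment. -/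
def sameColour {n : ℕ} (c : (Fin (n + 1) → I) → C) (y : I) (ξ : Θ) (f : ∀ η, η < ξ → I) : Set I :=
  {z | z < y ∧ (∀ η h, f η h < z) ∧ ∀ t : Fin n → Θ, StrictMono t → ∀ h : ∀ i, t i < ξ,
    c (Fin.snoc (α := fun _ => I) (fun i => f (t i) (h i)) z) =
      c (Fin.snoc (α := fun _ => I) (fun i => f (t i) (h i)) y)}

open Classical in
/-- The greedy sequence of elements of the same colour as `y`. -/
noncomputable def greedy {n : ℕ} (c : (Fin (n + 1) → I) → C) (y : I) : Θ → I :=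
  (wellFounded_lt (α := Θ)).fix fun ξ f =>
    if h : (sameColour c y ξ f).Nonempty then (wellFounded_lt (α := I)).min _ h else y

/-- The candidates for the element with index `ξ` of the greedy sequence. -/
def candidates {n : ℕ} (c : (Fin (n + 1) → I) → C) (y : I) (ξ : Θ) : Set I :=
  sameColour c y ξ fun η _ => greedy c y η

theorem greedy_of_nonempty {n : ℕ} {c : (Fin (n + 1) → I) → C} {y : I} {ξ : Θ}
    (h : (candidates c y ξ).Nonempty) :
    greedy c y ξ = (wellFounded_lt (α := I)).min _ h := by
  rw [greedy, WellFounded.fix_eq]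
  exact dif_pos h

theorem greedy_mem {n : ℕ} {c : (Fin (n + 1) → I) → C} {y : I} {ξ : Θ}
    (h : (candidates c y ξ).Nonempty) : greedy c y ξ ∈ candidates c y ξ := by
  rw [greedy_of_nonempty h]
  exact WellFounded.min_mem _ _ _

theorem greedy_le {n : ℕ} {c : (Fin (n + 1) → I) → C} {y : I} {ξ : Θ} {z : I}
    (h : z ∈ candidates c y ξ) : greedy c y ξ ≤ z := by
  rw [greedy_of_nonempty ⟨z, h⟩]
  exact not_lt.1 (WellFounded.not_lt_min _ _ h)

/-- A candidate is tested only against the earlier greedy elements and the colours of `y` over them,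
and here these data agree for `y` and `y'`. -/
theorem mem_candidates_of_lt {n : ℕ} {c : (Fin (n + 1) → I) → C} {y y' : I} (hy : y < y') {ξ : Θ}
    (hf : ∀ η < ξ, greedy c y η = greedy c y' η)
    (hc : ∀ t : Fin n → Θ, c (Fin.snoc (α := fun _ => I) (fun i => greedy c y (t i)) y) =
      c (Fin.snoc (α := fun _ => I) (fun i => greedy c y' (t i)) y')) {z : I} (hz : z < y) :
    z ∈ candidates c y ξ ↔ z ∈ candidates c y' ξ := by
  refine and_congr (iff_of_true hz (hz.trans hy)) (and_congr ?_ ?_)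
  · exact forall_congr' fun η => forall_congr' fun h => iff_of_eq (congrArg (· < z) (hf η h))
  · refine forall_congr' fun t => forall_congr' fun _ => forall_congr' fun h => ?_
    rw [hc t]
    simp only [hf _ (h _)]

/-- If every greedy sequence stopped, then `y` would be determined by the place `ζ y` where it stops
and by the colours of `y` over its sequence, which would inject `I` into the set of such codes. -/
theorem exists_candidates_nonempty {n : ℕ} (c : (Fin (n + 1) → I) → C)
    (hI : IsEmpty (I ↪ Θ × ((Fin n → Θ) → C))) :
    ∃ y, ∀ ξ : Θ, (candidates c y ξ).Nonempty := by
  by_contra! hcon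
  let ζ : I → Θ := fun y => (wellFounded_lt (α := Θ)).min {ξ | candidates c y ξ = ∅} (hcon y)
  have hζ : ∀ y, candidates c y (ζ y) = ∅ := fun y => WellFounded.min_mem _ _ (hcon y)
  have hζ' : ∀ y, ∀ η < ζ y, (candidates c y η).Nonempty := fun y η hη => by
    by_contra h
    exact WellFounded.not_lt_min (wellFounded_lt (α := Θ)) {ξ | candidates c y ξ = ∅}
      (Set.not_nonempty_iff_eq_empty.1 h) hη
  let code : I → Θ × ((Fin n → Θ) → C) := fun y =>
    (ζ y, fun t => c (Fin.snoc (α := fun _ => I) (fun i => greedy c y (t i)) y))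
  have key : ∀ y y', y < y' → code y ≠ code y' := by
    intro y y' hy hcode
    have h₁ : ζ y = ζ y' := congrArg Prod.fst hcode
    have h₂ := congrFun (congrArg Prod.snd hcode)
    -- Below `y` the candidates are the same; the minimum for `y'` is at most the one for `y`, hence
    -- also below `y`, and the two coincide.
    have hf : ∀ η, η < ζ y → greedy c y η = greedy c y' η := by
      intro η
      induction η using (wellFounded_lt (α := Θ)).induction with
      | _ η ih =>
      intro hη
      have hη' := fun z => mem_candidates_of_lt (z := z) hy (fun η' h => ih η' h (h.trans hη)) h₂
      have hmem := greedy_mem (hζ' y η hη)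
      have hle := greedy_le ((hη' _ hmem.1).1 hmem)
      have hmem' := greedy_mem (hζ' y' η (h₁ ▸ hη))
      exact le_antisymm (greedy_le ((hη' _ (hle.trans_lt hmem.1)).2 hmem')) hle
    -- `y` itself would continue the sequence of `y'` at the place where that sequence stops.
    have hy' : y ∈ candidates c y' (ζ y) := by
      refine ⟨hy, fun η h => ?_, fun t _ ht => ?_⟩
      · change greedy c y' η < y
        rw [← hf η h]
        exact (greedy_mem (hζ' y η h)).1
      · exact (congrArg (fun f => c (Fin.snoc (α := fun _ => I) f y))
          (funext fun i => (hf _ (ht i)).symm)).trans (h₂ t)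
    rw [h₁, hζ] at hy'
    exact hy'
  refine hI.elim ⟨code, fun y y' h => ?_⟩
  by_contra hne
  rcases lt_or_gt_of_ne hne with h' | h'
  · exact key _ _ h' h
  · exact key _ _ h' h.symm

theorem mk_fun_lt {κ : Cardinal.{u}} (h₀ : ℵ₀ < κ) (h₂ : ∀ μ < κ, 2 ^ μ < κ) {X Y : Type u}
    (hX : #X < κ) (hY : #Y < κ) : #(X → Y) < κ := by
  rw [← power_def]
  refine lt_of_le_of_lt (power_le_power_right (cantor _).le) ?_
  rw [← power_mul]
  exact h₂ _ (mul_lt_of_lt h₀.le hY hX)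

/-- A weak form of the Erdős–Rado theorem. -/
theorem exists_homogeneous {κ : Cardinal.{u}} (h₀ : ℵ₀ < κ) (h₂ : ∀ μ < κ, 2 ^ μ < κ)
    {C : Type u} (hC : #C < κ) (n : ℕ) :
    ∃ (I : Type u) (_ : LinearOrder I), WellFoundedLT I ∧ #I < κ ∧
      ∀ c : (Fin n → I) → C, ∃ h : ℕ → I, StrictMono h ∧ ∃ a, ∀ j : Fin n → ℕ, StrictMono j →
        c (h ∘ j) = a := by
  induction n with
  | zero =>
    refine ⟨ULift ℕ, inferInstance, inferInstance, by simpa using h₀, fun c => ⟨ULift.up,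
      fun _ _ h => h, c Fin.elim0, fun j _ => congrArg c (funext fun i => i.elim0)⟩⟩
  | succ n ih =>
    obtain ⟨Θ, _, _, hΘ, hom⟩ := ih
    have hcode : #(Θ × ((ULift.{u} (Fin n) → Θ) → C)) < κ := by
      rw [mk_prod, lift_id, lift_id]
      refine mul_lt_of_lt h₀.le hΘ (mk_fun_lt h₀ h₂ (mk_fun_lt h₀ h₂ ?_ hΘ) hC)
      exact (lt_aleph0_of_finite _).trans h₀
    -- By Cantor's theorem too large to inject into the set of codes, yet still below `κ`.
    let ν : Cardinal.{u} := 2 ^ #(Θ × ((ULift.{u} (Fin n) → Θ) → C))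
    refine ⟨ν.ord.ToType, inferInstance, inferInstance, (mk_ord_toType ν).trans_lt (h₂ _ hcode), fun c => ?_⟩
    have hI : IsEmpty (ν.ord.ToType ↪ Θ × ((Fin n → Θ) → C)) := ⟨fun g => by
      have e : (Θ × ((Fin n → Θ) → C)) ≃ Θ × ((ULift.{u} (Fin n) → Θ) → C) :=
        Equiv.prodCongr (Equiv.refl _) (Equiv.arrowCongr
          (Equiv.arrowCongr Equiv.ulift.symm (Equiv.refl _)) (Equiv.refl _))
      have := mk_le_of_injective (g.trans e.toEmbedding).injective
      rw [mk_ord_toType] at this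
      exact absurd (cantor _) this.not_gt⟩
    obtain ⟨y, hy⟩ := exists_candidates_nonempty (Θ := Θ) c hI
    -- Along the greedy sequence the last entry of an increasing `n + 1`-tuple can be replaced by
    -- `y` without changing the colour, so only `n` arguments remain.
    obtain ⟨h, hh, a, ha⟩ := hom fun t =>
      c (Fin.snoc (α := fun _ => ν.ord.ToType) (fun i => greedy c y (t i)) y)
    refine ⟨fun m => greedy c y (h m), fun m m' hm => (greedy_mem (hy (h m'))).2.1 _ (hh hm), a,
      fun j hj => ?_⟩
    have hlt : ∀ i : Fin n, h (j i.castSucc) < h (j (Fin.last n)) := fun i =>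
      hh (hj (Fin.castSucc_lt_last i))
    have hmem := (greedy_mem (hy (h (j (Fin.last n))))).2.2 (fun i => h (j i.castSucc))
      (fun i i' hi => hh (hj (Fin.castSucc_lt_castSucc_iff.2 hi))) hlt
    rw [← ha (fun i => j i.castSucc) fun i i' hi => hj (Fin.castSucc_lt_castSucc_iff.2 hi)]
    refine Eq.trans (congrArg c ?_) hmem
    funext i
    induction i using Fin.lastCases <;> simp

end ErdosRado

end PosLogic

namespace PosLogic
variable {L : Lang.{u}}

/-! ### Saturation and indiscernible sequences -/

open Cardinal

/-- Saturation for positive predicates whose parameters form a small tuple instead of a set. -/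
theorem Str.IsSaturated.exists_forall {U : Str L} {κ : Cardinal.{u}} (hU : U.IsSaturated κ)
    {α δ : Type u} {σ : α → L.Sorts} {ρ : δ → L.Sorts} (hα : #α < κ) (hδ : #δ < κ)
    (c : U.Tuple ρ) {ι : Type*} {P : ι → U.Tuple σ → U.Tuple ρ → Prop}
    (hP : ∀ i, IsPos fun v : U.Tuple (Sum.elim σ ρ) =>
      P i (fun a => v (.inl a)) (fun d => v (.inr d)))
    (h : ∀ s : Finset ι, ∃ x, ∀ i ∈ s, P i x c) : ∃ x, ∀ i, P i x c := by
  classical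
  let A : Set U.Elem := Set.range fun d => ⟨ρ d, c d⟩
  have hφ : ∀ i, ∃ φ : FormulaOver U A σ, ∀ x, x ∈ φ.solutions ↔ P i x c := fun i => by
    obtain ⟨φ, hφ⟩ := (hP i).comp (σ := Sum.elim σ fun e : A => e.1.1)
      (F := fun v => Str.Tuple.append (fun a => v (.inl a))
        fun d => v (.inr ⟨⟨ρ d, c d⟩, d, rfl⟩)) (by
      rintro (a | d)
      · exact ⟨.var (σ := Sum.elim σ fun e : A => e.1.1) (.inl a), fun _ => rfl⟩
      · exact ⟨.var (σ := Sum.elim σ fun e : A => e.1.1) (.inr ⟨⟨ρ d, c d⟩, d, rfl⟩),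
          fun _ => rfl⟩)
    exact ⟨φ, fun x => hφ _⟩
  choose φ hφ using hφ
  obtain ⟨x, hx⟩ := hU α σ A (Set.range φ) hα (mk_range_le.trans_lt hδ) (by
    intro F hF hsub
    have hg : ∀ D : F, ∃ i, (φ i).solutions = D := fun D => by
      obtain ⟨_, ⟨i, rfl⟩, h⟩ := hsub D.2
      exact ⟨i, h⟩
    choose g hg using hg
    have := hF.to_subtype
    cases nonempty_fintype F
    obtain ⟨x, hx⟩ := h (Finset.univ.image g)
    refine ⟨x, fun D hD => ?_⟩
    have := (hφ _ x).2 (hx _ (Finset.mem_image_of_mem g (Finset.mem_univ ⟨D, hD⟩)))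
    rwa [hg] at this)
  exact ⟨x, fun i => (hφ i x).1 (hx _ ⟨i, rfl⟩)⟩

section Indiscernible

variable {γ ε : Type u} {ρ : γ → L.Sorts} {τ : ε → L.Sorts}

/-- A formula with variables for finitely many terms of a sequence of tuples, and parameters. -/
abbrev Schema (ρ : γ → L.Sorts) (τ : ε → L.Sorts) : Type u :=
  Σ n : ℕ, Formula (Sum.elim (fun q : Fin n × γ => ρ q.2) τ)

/-- The formula holds at all increasing tuples from the sequence. -/
def Schema.HoldsOn {U : Str L} (e : U.Tuple τ) (s : Schema ρ τ) {I : Type*} [Preorder I]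
    (w : I → U.Tuple ρ) : Prop :=
  ∀ j : Fin s.1 → I, StrictMono j → s.2.Holds U (Str.Tuple.append (fun q => w (j q.1) q.2) e)

theorem Schema.HoldsOn.comp {U : Str L} {e : U.Tuple τ} {s : Schema ρ τ} {I J : Type*}
    [Preorder I] [Preorder J] {w : I → U.Tuple ρ} (h : s.HoldsOn e w) {f : J → I}
    (hf : StrictMono f) : s.HoldsOn e (w ∘ f) := fun j hj => h (f ∘ j) (hf.comp hj)

/-- Finitely many of the conditions mention finitely many indices from `I`, and these embed into `ℕ`
in order; saturation does the rest. -/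
theorem exists_holdsOn {U : Str L} {κ : Cardinal.{u}} (hU : U.IsSaturated κ) (h₀ : ℵ₀ < κ)
    (hγ : #γ < κ) (hε : #ε < κ) (e : U.Tuple τ) {p : Set (Schema ρ τ)}
    (hp : ∀ p₀ : Finset (Schema ρ τ), ↑p₀ ⊆ p → ∃ w : ℕ → U.Tuple ρ, ∀ s ∈ p₀, s.HoldsOn e w)
    {I : Type u} [LinearOrder I] (hI : #I < κ) :
    ∃ w : I → U.Tuple ρ, ∀ s ∈ p, s.HoldsOn e w := by
  classical
  obtain ⟨x, hx⟩ := hU.exists_forall (α := I × γ) (σ := fun q => ρ q.2)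
    (by rw [mk_prod, lift_id, lift_id]; exact mul_lt_of_lt h₀.le hI hγ) hε e
    (ι := Σ s : p, {j : Fin s.1.1 → I // StrictMono j})
    (P := fun i x e => i.1.1.2.Holds U (Str.Tuple.append (fun q => x (i.2.1 q.1, q.2)) e))
    (fun i => i.1.1.2.isPos.comp (by
      rintro (q | d)
      · exact ⟨.var (σ := Sum.elim (fun q : I × γ => ρ q.2) τ) (.inl (i.2.1 q.1, q.2)),
          fun _ => rfl⟩
      · exact ⟨.var (σ := Sum.elim (fun q : I × γ => ρ q.2) τ) (.inr d), fun _ => rfl⟩))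
    (fun t => by
      obtain ⟨w, hw⟩ := hp (t.image fun i => i.1.1) (by
        intro s hs
        obtain ⟨i, -, rfl⟩ := Finset.mem_image.1 hs
        exact i.1.2)
      let F : Finset I := t.biUnion fun i => Finset.univ.image i.2.1
      -- The number of elements of `F` below `i`, which is strictly increasing on `F`.
      let h : I → ℕ := fun i => (F.filter (· < i)).card
      refine ⟨fun q => w (h q.1) q.2, fun i hi => ?_⟩
      refine hw i.1.1 (Finset.mem_image_of_mem _ hi) (h ∘ i.2.1) fun a b hab => ?_
      refine Finset.card_lt_card (Finset.ssubset_iff_subset_ne.2 ⟨fun z hz => ?_, fun he => ?_⟩)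
      · rw [Finset.mem_filter] at hz ⊢
        exact ⟨hz.1, hz.2.trans (i.2.2 hab)⟩
      · have : i.2.1 a ∈ F.filter (· < i.2.1 b) := Finset.mem_filter.2
          ⟨Finset.mem_biUnion.2 ⟨i, hi, Finset.mem_image_of_mem _ (Finset.mem_univ _)⟩, i.2.2 hab⟩
        rw [← he] at this
        exact lt_irrefl _ (Finset.mem_filter.1 this).2)
  exact ⟨fun i g => x (i, g), fun s hs j hj => hx ⟨⟨s, hs⟩, j, hj⟩⟩

/-- The sets of schemas that hold on some sequence. -/
def realisable {U : Str L} (e : U.Tuple τ) : Set (Set (Schema ρ τ)) :=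
  {p | ∃ w : ℕ → U.Tuple ρ, ∀ s ∈ p, s.HoldsOn e w}

/-- Zorn's lemma applies because saturation realises the union of a chain. -/
theorem exists_maximal_realisable {U : Str L} {κ : Cardinal.{u}} (hU : U.IsSaturated κ)
    (h₀ : ℵ₀ < κ) (hγ : #γ < κ) (hε : #ε < κ) (e : U.Tuple τ) {p : Set (Schema ρ τ)}
    (hp : p ∈ realisable e) : ∃ m, p ⊆ m ∧ Maximal (· ∈ realisable e) m := by
  refine zorn_subset_nonempty _ (fun c hc hchain hne => ⟨⋃₀ c, ?_, fun s hs =>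
    Set.subset_sUnion_of_mem hs⟩) p hp
  obtain ⟨w, hw⟩ := exists_holdsOn hU h₀ hγ hε e (p := ⋃₀ c) (fun p₀ hp₀ => by
    obtain ⟨q, hq, hsub⟩ := hchain.directedOn.exists_mem_subset_of_finset_subset_biUnion
      hne (f := id) (s := p₀) (by simpa [Set.sUnion_eq_biUnion] using hp₀)
    obtain ⟨w, hw⟩ := hc hq
    exact ⟨w, fun s hs => hw s (hsub hs)⟩) (I := ULift ℕ) (by simpa using h₀)
  exact ⟨w ∘ ULift.up, fun s hs => (hw s hs).comp fun _ _ h => h⟩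

/-- Colour each tuple of a long realisation of `m` by `none` if the formula holds there, and
otherwise by a positive formula incompatible with it. On a homogeneous subsequence the formula, or
else the incompatible one, holds at all increasing tuples and so lies in `m` by maximality; the
second case contradicts `hs`. Hence all increasing tuples of `w` satisfy the same positive formulas
over `e`. -/
theorem mem_of_maximal_realisable {T : Theory L} {κ : Cardinal.{u}} {U : Str L}
    (hU : IsMonster T κ U) (hγ : #γ < κ) (hε : #ε < κ) {e : U.Tuple τ} {m : Set (Schema ρ τ)}
    (hm : Maximal (· ∈ realisable e) m) {I : Type*} [Preorder I] {w : I → U.Tuple ρ}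
    (hw : ∀ s ∈ m, s.HoldsOn e w) (s : Schema ρ τ) {j : Fin s.1 → I} (hj : StrictMono j)
    (hs : s.2.Holds U (Str.Tuple.append (fun q => w (j q.1) q.2) e)) : s ∈ m := by
  classical
  have h₀ := hU.aleph0_lt
  obtain ⟨n, φ⟩ := s
  have hC : #(Option (Formula (Sum.elim (fun q : Fin n × γ => ρ q.2) τ))) < κ := by
    rw [mk_option]
    refine add_lt_of_lt h₀.le (Formula.mk_lt hU.card_lt ?_ _) (one_lt_aleph0.trans h₀)
    rw [mk_sum, mk_prod, lift_id, lift_id]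
    refine add_lt_of_lt h₀.le (mul_lt_of_lt h₀.le ?_ ?_) hε
    · simpa using natCast_lt_aleph0.trans h₀
    · simpa using hγ
  obtain ⟨J, _, -, hJ, hom⟩ := exists_homogeneous h₀ (fun _ => hU.two_power_lt) hC n
  obtain ⟨v, hv⟩ := exists_holdsOn hU.saturated h₀ hγ hε e (p := m) (fun p₀ hp₀ =>
    hm.prop.imp fun w hw s hs => hw s (hp₀ hs)) hJ
  have hc : ∀ t : Fin n → J, ∃ o : Option (Formula (Sum.elim (fun q : Fin n × γ => ρ q.2) τ)),
      (o = none → φ.Holds U (Str.Tuple.append (fun q => v (t q.1) q.2) e)) ∧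
      ∀ ψ, o = some ψ → ψ.Holds U (Str.Tuple.append (fun q => v (t q.1) q.2) e) ∧
        ∀ x, ψ.Holds U x → ¬ φ.Holds U x := fun t => by
    by_cases h : φ.Holds U (Str.Tuple.append (fun q => v (t q.1) q.2) e)
    · exact ⟨none, fun _ => h, by simp⟩
    · obtain ⟨Q, ⟨ψ, hψ⟩, hQ, hd⟩ := hU.pec.exists_witness φ.isPos _ h
      refine ⟨some ψ, by simp, fun ψ' e => ?_⟩
      obtain rfl := Option.some_injective _ e
      exact ⟨(hψ _).2 hQ, fun x hx => hd x ((hψ x).1 hx)⟩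
  choose c hc₁ hc₂ using hc
  obtain ⟨h, hh, a, ha⟩ := hom c
  have hadd : ∀ s : Schema ρ τ, s.HoldsOn e (v ∘ h) → s ∈ m := fun s hs => by
    have : insert s m ∈ realisable e := ⟨v ∘ h, fun s' hs' => by
      rcases hs' with rfl | hs'
      · exact hs
      · exact (hv s' hs').comp hh⟩
    exact hm.le_of_ge this (Set.subset_insert s m) (Set.mem_insert s m)
  rcases a with _ | ψ
  · exact hadd _ fun j hj => hc₁ _ (ha j hj)
  · have hψ : (⟨n, ψ⟩ : Schema ρ τ) ∈ m := hadd _ fun j hj => (hc₂ _ _ (ha j hj)).1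
    exact absurd hs ((hc₂ _ _ (ha Fin.val Fin.val_strictMono)).2 _ (hw _ hψ j hj))

/-- The existence of indiscernible sequences: any sequence can be replaced by an indiscernible one
of any small order type. -/
theorem exists_indiscernible {T : Theory L} {κ : Cardinal.{u}} {U : Str L}
    (hU : IsMonster T κ U) (hγ : #γ < κ) (hε : #ε < κ) (e : U.Tuple τ) (w : ℕ → U.Tuple ρ)
    {I : Type u} [LinearOrder I] (hI : #I < κ) :
    ∃ w' : I → U.Tuple ρ,
      (∀ (n : ℕ) (P : (Fin n → U.Tuple ρ) → U.Tuple τ → Prop),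
        (IsPos fun v : U.Tuple (Sum.elim (fun q : Fin n × γ => ρ q.2) τ) =>
          P (fun i g => v (.inl (i, g))) fun d => v (.inr d)) →
        (∀ j : Fin n → ℕ, StrictMono j → P (fun i => w (j i)) e) →
        ∀ j : Fin n → I, StrictMono j → P (fun i => w' (j i)) e) ∧
      ∀ P : (I → U.Tuple ρ) → U.Tuple τ → Prop,
        (IsPos fun v : U.Tuple (Sum.elim (fun q : I × γ => ρ q.2) τ) =>
          P (fun i g => v (.inl (i, g))) fun d => v (.inr d)) →
        ∀ g : I → I, StrictMono g → P w' e → P (fun i => w' (g i)) e := by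
  classical
  have h₀ := hU.aleph0_lt
  obtain ⟨m, hpm, hm⟩ := exists_maximal_realisable hU.saturated h₀ hγ hε e
    (p := {s : Schema ρ τ | s.HoldsOn e w}) ⟨w, fun s hs => hs⟩
  obtain ⟨w', hw'⟩ := exists_holdsOn hU.saturated h₀ hγ hε e (p := m) (fun p₀ hp₀ =>
    hm.prop.imp fun w hw s hs => hw s (hp₀ hs)) hI
  refine ⟨w', fun n P ⟨φ, hφ⟩ h j hj => ?_, fun P hP g hg h => ?_⟩
  · have hmem : (⟨n, φ⟩ : Schema ρ τ) ∈ m := hpm fun j hj => (hφ _).2 (h j hj)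
    exact (hφ _).1 (hw' _ hmem j hj)
  · obtain ⟨S, hS⟩ := hP.exists_support
    obtain ⟨P', hP', hPP'⟩ := hS S subset_rfl
    -- Only the finitely many indices in `F` occur in `P`. Listed in increasing order they turn `P`
    -- into a schema, and `g` moves this list to another increasing one.
    let F : Finset I := (S.preimage .inl Sum.inl_injective.injOn).image Prod.fst
    have hF : ∀ q : I × γ, .inl q ∈ S → q.1 ∈ F := fun q hq =>
      Finset.mem_image_of_mem _ (Finset.mem_preimage.2 hq)
    let ι := F.orderIsoOfFin rfl
    let G : (Fin F.card → U.Tuple ρ) → U.Tuple τ →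
        U.Tuple (fun a : S => Sum.elim (fun q : I × γ => ρ q.2) τ a) := fun u d => fun
      | ⟨.inl q, hq⟩ => u (ι.symm ⟨q.1, hF q hq⟩) q.2
      | ⟨.inr b, _⟩ => d b
    have hG : ∀ f : I → I, P (fun i => w' (f i)) e ↔ P' (G (fun i => w' (f (ι i))) e) := fun f => by
      refine (hPP' (Str.Tuple.append (fun q => w' (f q.1) q.2) e)).trans (iff_of_eq (congrArg P' ?_))
      funext a
      rcases a with ⟨q | b, hq⟩
      · simp only [G, OrderIso.apply_symm_apply]
        rfl
      · rfl
    obtain ⟨φ, hφ⟩ := hP'.comp (σ := Sum.elim (fun q : Fin F.card × γ => ρ q.2) τ)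
      (F := fun v => G (fun i g => v (.inl (i, g))) fun d => v (.inr d)) (by
      rintro ⟨q | b, hq⟩
      · exact ⟨.var (σ := Sum.elim (fun q : Fin F.card × γ => ρ q.2) τ)
          (.inl (ι.symm ⟨q.1, hF q hq⟩, q.2)), fun _ => rfl⟩
      · exact ⟨.var (σ := Sum.elim (fun q : Fin F.card × γ => ρ q.2) τ) (.inr b), fun _ => rfl⟩)
    have hι : StrictMono fun i => (ι i : I) := fun a b h => ι.strictMono h
    have hmem : (⟨F.card, φ⟩ : Schema ρ τ) ∈ m := mem_of_maximal_realisable hU hγ hε hm hw'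
      ⟨F.card, φ⟩ hι ((hφ _).2 ((hG id).1 h))
    exact (hG g).2 ((hφ _).1 (hw' _ hmem _ (hg.comp hι)))

end Indiscernible

end PosLogic

namespace PosLogic
variable {L : Lang.{u}}

/-! ### Conditions over types -/

open Cardinal

/-- Restricting a condition over `E` along a term map. -/
theorem exists_solutions_comp {U : Str L} {E : Set U.Elem} {α β : Type u} {σ : α → L.Sorts}
    {τ : β → L.Sorts} {F : U.Tuple σ → U.Tuple τ} (hF : IsTermMap F) (χ : FormulaOver U E τ) :
    ∃ φ : FormulaOver U E σ, ∀ x, x ∈ φ.solutions ↔ F x ∈ χ.solutions := by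
  choose t ht using hF
  obtain ⟨φ, hφ⟩ := (Formula.isPos (M := U) χ).comp (σ := Sum.elim σ fun e : E => e.1.1)
    (F := fun v => Str.Tuple.append (F fun a => v (.inl a)) fun d => v (.inr d)) (by
    rintro (b | d)
    · exact ⟨(t b).subst fun a => .var (σ := Sum.elim σ fun e : E => e.1.1) (.inl a),
        fun v => (Term.val_subst _ _ _ _).trans (ht b _)⟩
    · exact ⟨.var (σ := Sum.elim σ fun e : E => e.1.1) (.inr d), fun _ => rfl⟩)
  exact ⟨φ, fun x => hφ (x.append (U.enum E))⟩

theorem tp_exists_and {U : Str L} {E : Set U.Elem} {α : Type u} {σ : α → L.Sorts}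
    (a : U.Tuple σ) (s : Finset (tp U a E)) :
    ∃ φ ∈ tp U a E, ∀ x ∈ φ.solutions, ∀ χ ∈ s, x ∈ χ.1.solutions := by
  obtain ⟨φ, hφ⟩ := IsPos.forall_finset (M := U) s
    (P := fun χ v => Formula.Holds U χ.1 v) fun χ _ => Formula.isPos χ.1
  exact ⟨φ, (hφ _).2 fun χ _ => χ.2, fun x hx => (hφ _).1 hx⟩

/-- A type is closed under finite conjunctions, so it can be tested one formula at a time. -/
theorem consistent_tp_union {U : Str L} {E : Set U.Elem} {α : Type u} {σ : α → L.Sorts}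
    (a : U.Tuple σ) {ι : Type*} (D : ι → Set (U.Tuple σ))
    (h : ∀ φ ∈ tp U a E, ∃ x ∈ φ.solutions, ∀ i, x ∈ D i) :
    Consistent (FormulaOver.solutions '' tp U a E ∪ Set.range D) := by
  classical
  intro F hF hsub
  have hg : ∀ X : F, ∃ φ : tp U a E, X.1 ∈ Set.range D ∨ φ.1.solutions = X := fun X => by
    rcases hsub X.2 with ⟨φ, hφ, e⟩ | h
    · exact ⟨⟨φ, hφ⟩, .inr e⟩
    · exact ⟨⟨.top, trivial⟩, .inl h⟩
  choose g hg using hg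
  have := hF.to_subtype
  cases nonempty_fintype F
  obtain ⟨φ, hφ, hall⟩ := tp_exists_and a (Finset.univ.image g)
  obtain ⟨x, hx, hD⟩ := h φ hφ
  refine ⟨x, fun X hX => ?_⟩
  rcases hg ⟨X, hX⟩ with ⟨i, e⟩ | e
  · rw [← show D i = X from e]
    exact hD i
  · rw [← show (g ⟨X, hX⟩).1.solutions = X from e]
    exact hall x hx _ (Finset.mem_image_of_mem g (Finset.mem_univ _))

theorem Consistent.exists_mem {U : Str L} {E : Set U.Elem} {α : Type u} {σ : α → L.Sorts}
    {π : Set (FormulaOver U E σ)} {R : Type*} [Finite R] {D : R → Set (U.Tuple σ)}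
    (h : Consistent (FormulaOver.solutions '' π ∪ Set.range D)) {φ : FormulaOver U E σ}
    (hφ : φ ∈ π) : ∃ x ∈ φ.solutions, ∀ r, x ∈ D r := by
  obtain ⟨x, hx⟩ := h (insert φ.solutions (Set.range D)) ((Set.finite_range D).insert _) (by
    rintro X (rfl | hX)
    · exact .inl ⟨φ, hφ, rfl⟩
    · exact .inr hX)
  exact ⟨x, hx _ (Set.mem_insert _ _), fun r => hx _ (Set.mem_insert_of_mem _ ⟨r, rfl⟩)⟩

/-! ### Indiscernible arrays -/

/-- An array of tuples, indiscernible over `E` in the lexicographic order of its rows, with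
positive predicates `Φ r` that form an inp-pattern in the type of `c` over `E`. -/
structure IndiscArray (U : Str L) (E : Set U.Elem) {ξ : Type u} {ς : ξ → L.Sorts}
    (c : U.Tuple ς) (R : Type u) [LinearOrder R] : Type (u + 1) where
  /-- the index set of the tuples -/
  γ : Type u
  finite : Finite γ
  /-- the sorts of the tuples -/
  ρ : γ → L.Sorts
  /-- the entries -/
  z : R ×ₗ ℕ → U.Tuple ρ
  /-- the predicates that define the pattern -/
  Φ : R → U.Tuple ς → U.Tuple ρ → Prop
  isPos : ∀ r, IsPos fun v : U.Tuple (Sum.elim ς ρ) =>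
    Φ r (fun a => v (.inl a)) fun d => v (.inr d)
  row : ∀ r, ∃ (k : ℕ) (Ψ : (Fin k → U.Tuple ρ) → Prop),
    (IsPos fun v : U.Tuple (fun q : Fin k × γ => ρ q.2) => Ψ fun i g => v (i, g)) ∧
    (¬ ∃ (x : U.Tuple ς) (y : Fin k → U.Tuple ρ), Ψ y ∧ ∀ i, Φ r x (y i)) ∧
    ∀ j : Fin k → ℕ, StrictMono j → Ψ fun i => z (toLex (r, j i))
  path : ∀ φ ∈ tp U c E, ∀ f : R → ℕ, ∃ x ∈ φ.solutions, ∀ r, Φ r x (z (toLex (r, f r)))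
  shift : ∀ P : (R ×ₗ ℕ → U.Tuple ρ) → U.Tuple (fun e : E => e.1.1) → Prop,
    (IsPos fun v : U.Tuple (Sum.elim (fun q : (R ×ₗ ℕ) × γ => ρ q.2) fun e : E => e.1.1) =>
      P (fun i g => v (.inl (i, g))) fun d => v (.inr d)) →
    ∀ g : R ×ₗ ℕ → R ×ₗ ℕ, StrictMono g → P z (U.enum E) → P (fun i => z (g i)) (U.enum E)

theorem IsPos.exists_support_right {M : Str L} {α : Type w} {β : Type w'} {σ : α → L.Sorts}
    {ρ : β → L.Sorts} {P : M.Tuple σ → M.Tuple ρ → Prop}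
    (h : IsPos fun v : M.Tuple (Sum.elim σ ρ) => P (fun a => v (.inl a)) fun d => v (.inr d)) :
    ∃ S : Finset β, ∀ S', S ⊆ S' → ∃ P' : M.Tuple σ → M.Tuple (fun b : S' => ρ b) → Prop,
      (IsPos fun v : M.Tuple (Sum.elim σ fun b : S' => ρ b) =>
        P' (fun a => v (.inl a)) fun d => v (.inr d)) ∧
      ∀ x y, P x y ↔ P' x fun b => y b := by
  classical
  obtain ⟨S, hS⟩ := h.exists_support
  obtain ⟨P', hP', e⟩ := hS S subset_rfl
  refine ⟨S.preimage .inr Sum.inr_injective.injOn, fun S' h' => ?_⟩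
  have hb : ∀ b, .inr b ∈ S → b ∈ S' := fun b hb => h' (Finset.mem_preimage.2 hb)
  let G : M.Tuple σ → M.Tuple (fun b : S' => ρ b) → M.Tuple (fun a : S => Sum.elim σ ρ a) :=
    fun x y => fun
      | ⟨.inl a, _⟩ => x a
      | ⟨.inr b, h⟩ => y ⟨b, hb b h⟩
  refine ⟨fun x y => P' (G x y), hP'.comp ?_, fun x y => (e (x.append y)).trans
    (iff_of_eq (congrArg P' ?_))⟩
  · rintro ⟨a | b, h⟩
    · exact ⟨.var (σ := Sum.elim σ fun b : S' => ρ b) (.inl a), fun _ => rfl⟩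
    · exact ⟨.var (σ := Sum.elim σ fun b : S' => ρ b) (.inr ⟨b, hb b h⟩), fun _ => rfl⟩
  · funext a
    rcases a with ⟨a | b, h⟩ <;> rfl

theorem IsPos.exists_support_pi {M : Str L} {κ : Type w} {β : Type w'}
    {ρ : β → L.Sorts} {P : (κ → M.Tuple ρ) → Prop}
    (h : IsPos fun v : M.Tuple (fun q : κ × β => ρ q.2) => P fun i g => v (i, g)) :
    ∃ S : Finset β, ∀ S', S ⊆ S' → ∃ P' : (κ → M.Tuple (fun b : S' => ρ b)) → Prop,
      (IsPos fun v : M.Tuple (fun q : κ × S' => ρ q.2) => P' fun i g => v (i, g)) ∧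
      ∀ y : κ → M.Tuple ρ, P y ↔ P' fun i b => y i b := by
  classical
  obtain ⟨S, hS⟩ := h.exists_support
  obtain ⟨P', hP', e⟩ := hS S subset_rfl
  refine ⟨S.image Prod.snd, fun S' h' => ?_⟩
  have hb : ∀ q, q ∈ S → q.2 ∈ S' := fun q hq => h' (Finset.mem_image_of_mem _ hq)
  refine ⟨fun y => P' fun q => y q.1.1 ⟨q.1.2, hb _ q.2⟩, hP'.comp fun q =>
    ⟨.var (σ := fun q : κ × S' => ρ q.2) (q.1.1, ⟨q.1.2, hb _ q.2⟩), fun _ => rfl⟩,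
    fun y => e fun q => y q.1 q.2⟩

/-- The entries of column `m` in all rows are joined into one tuple `z m`, cut down to the finitely
many coordinates that occur in the formulas. A single sequence of small tuples is what the
extraction of indiscernibles accepts; the tuples of a pattern may be large. -/
theorem InpPattern.exists_finite {U : Str L} {E : Set U.Elem} {ξ : Type u} {ς : ξ → L.Sorts}
    {π : Set (FormulaOver U E ς)} {R : Type u} [Finite R] (p : InpPattern U π R) :
    ∃ (γ : Type u) (_ : Finite γ) (ρ : γ → L.Sorts) (z : ℕ → U.Tuple ρ)
      (Φ : R → U.Tuple ς → U.Tuple ρ → Prop),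
      (∀ r, IsPos fun v : U.Tuple (Sum.elim ς ρ) =>
        Φ r (fun a => v (.inl a)) fun d => v (.inr d)) ∧
      (∀ r, ∃ (k : ℕ) (Ψ : (Fin k → U.Tuple ρ) → Prop),
        (IsPos fun v : U.Tuple (fun q : Fin k × γ => ρ q.2) => Ψ fun i g => v (i, g)) ∧
        (¬ ∃ (x : U.Tuple ς) (y : Fin k → U.Tuple ρ), Ψ y ∧ ∀ i, Φ r x (y i)) ∧
        ∀ j : Fin k → ℕ, StrictMono j → Ψ fun i => z (j i)) ∧
      ∀ f : R → ℕ, Consistent (FormulaOver.solutions '' π ∪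
        Set.range fun r => {x : U.Tuple ς | Φ r x (z (f r))}) := by
  classical
  cases nonempty_fintype R
  let ρ' : (Σ r, p.β r) → L.Sorts := fun q => p.τ q.1 q.2
  let z' : ℕ → U.Tuple ρ' := fun m q => p.a q.1 m q.2
  choose k ψ hψ₁ hψ₂ using p.row
  have h₁ : ∀ r, IsPos fun v : U.Tuple (Sum.elim ς ρ') =>
      (p.φ r).Holds U (Str.Tuple.append (fun a => v (.inl a)) fun d => v (.inr ⟨r, d⟩)) := fun r =>
    (p.φ r).isPos.comp (by
      rintro (a | b)
      · exact ⟨.var (σ := Sum.elim ς ρ') (.inl a), fun _ => rfl⟩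
      · exact ⟨.var (σ := Sum.elim ς ρ') (.inr ⟨r, b⟩), fun _ => rfl⟩)
  have h₂ : ∀ r, IsPos fun v : U.Tuple (fun q : Fin (k r) × (Σ r, p.β r) => ρ' q.2) =>
      (ψ r).Holds U fun q => v (q.1, ⟨r, q.2⟩) := fun r =>
    (ψ r).isPos.comp fun q =>
      ⟨.var (σ := fun q : Fin (k r) × (Σ r, p.β r) => ρ' q.2) (q.1, ⟨r, q.2⟩), fun _ => rfl⟩
  choose S₁ hS₁ using fun r => IsPos.exists_support_right
    (P := fun (x : U.Tuple ς) (v : U.Tuple ρ') => (p.φ r).Holds U (Str.Tuple.append x fun d => v ⟨r, d⟩)) (h₁ r)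
  choose S₂ hS₂ using fun r => IsPos.exists_support_pi
    (P := fun v : Fin (k r) → U.Tuple ρ' => (ψ r).Holds U fun q => v q.1 ⟨r, q.2⟩) (h₂ r)
  let S := Finset.univ.biUnion fun r => S₁ r ∪ S₂ r
  have hS : ∀ r, S₁ r ∪ S₂ r ⊆ S := fun r =>
    Finset.subset_biUnion_of_mem (fun r => S₁ r ∪ S₂ r) (Finset.mem_univ r)
  choose Φ hΦ hΦe using fun r => hS₁ r S (Finset.union_subset_left (hS r))
  choose Ψ hΨ hΨe using fun r => hS₂ r S (Finset.union_subset_right (hS r))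
  refine ⟨S, inferInstance, fun b => ρ' b, fun m b => z' m b, Φ, hΦ, fun r => ⟨k r, Ψ r, hΨ r,
    ?_, fun j hj => (hΨe r fun i => z' (j i)).1 (hψ₂ r j hj)⟩, fun f => ?_⟩
  · rintro ⟨x, y, hy, hxy⟩
    let y' : Fin (k r) → U.Tuple ρ' := fun i b => if h : b ∈ S then y i ⟨b, h⟩ else z' 0 b
    have hy' : ∀ i, (fun b : S => y' i b) = y i := fun i => funext fun b => dif_pos b.2
    refine hψ₁ r ⟨x, fun i b => y' i ⟨r, b⟩, (hΨe r y').2 ?_, fun i => (hΦe r x (y' i)).2 ?_⟩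
    · rwa [show (fun i (b : S) => y' i b) = y from funext hy']
    · rw [hy']
      exact hxy i
  · convert p.path f using 4 with r x
    exact funext fun x => propext (hΦe r x (z' (f r))).symm

/-- The sequence of columns is stretched to the order `R ×ₗ ℕ`, and `Φ r` is applied on the segment
of `r`. Increasing tuples inside a segment give the row condition. A path, listed by increasing
rows, is an increasing tuple whatever the entries are, and gives consistency. -/
theorem InpPattern.exists_indiscArray {T : Theory L} {κ : Cardinal.{u}} {U : Str L}
    (hU : IsMonster T κ U) {E : Set U.Elem} (hE : #E < κ) {ξ : Type u} {ς : ξ → L.Sorts}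
    {c : U.Tuple ς} {R : Type u} [LinearOrder R] [Finite R] (p : InpPattern U (tp U c E) R) :
    Nonempty (IndiscArray U E c R) := by
  classical
  have h₀ := hU.aleph0_lt
  obtain ⟨γ, hγ, ρ, z, Φ, hΦ, hrow, hpath⟩ := p.exists_finite
  have hI : #(R ×ₗ ℕ) < κ := by
    have : #(R ×ₗ ℕ) = #(R × ℕ) := mk_congr ofLex
    rw [this, mk_prod]
    refine mul_lt_of_lt h₀.le ?_ ?_
    · simpa using (lt_aleph0_of_finite R).trans h₀
    · simpa using h₀
  obtain ⟨z', h₁, h₂⟩ := exists_indiscernible hU ((lt_aleph0_of_finite γ).trans h₀) hE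
    (U.enum E) z hI
  refine ⟨⟨γ, hγ, ρ, z', Φ, hΦ, fun r => ?_, fun φ hφ f => ?_, h₂⟩⟩
  · obtain ⟨k, Ψ, hΨ, hd, hz⟩ := hrow r
    refine ⟨k, Ψ, hΨ, hd, fun j hj => h₁ k (fun y _ => Ψ y) (hΨ.comp fun q =>
      ⟨.var (σ := Sum.elim (fun q : Fin k × γ => ρ q.2) fun e : E => e.1.1) (.inl q),
        fun _ => rfl⟩) hz (fun i => toLex (r, j i)) fun i i' h => ?_⟩
    exact Prod.Lex.toLex_lt_toLex.2 (.inr ⟨rfl, hj h⟩)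
  · cases nonempty_fintype R
    let o : Fin (Fintype.card R) ≃o R := Fintype.orderIsoFinOfCardEq R rfl
    obtain ⟨x, hx, hr⟩ := h₁ (Fintype.card R)
      (fun y e => ∃ x : U.Tuple ς, φ.Holds U (x.append e) ∧ ∀ i, Φ (o i) x (y i))
      (by
        refine IsPos.exists c (IsPos.and ?_ (IsPos.forall_finite fun i => ?_))
        · exact Formula.isPos_append φ (.var Sum.inr) (.var fun d => Sum.inl (Sum.inr d))
        · exact (hΦ (o i)).comp₂ (P := Φ (o i)) (.var Sum.inr)
            (.var fun g => Sum.inl (Sum.inl (i, g))))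
      (fun j _ => by
        obtain ⟨x, hx, hr⟩ := (hpath fun r => j (o.symm r)).exists_mem hφ
        refine ⟨x, hx, fun i => ?_⟩
        have : Φ (o i) x (z (j (o.symm (o i)))) := hr (o i)
        rwa [o.symm_apply_apply] at this)
      (fun i => toLex (o i, f (o i)))
      (fun i i' h => Prod.Lex.toLex_lt_toLex.2 (.inl (o.strictMono h)))
    refine ⟨x, hx, fun r => ?_⟩
    simpa only [o.apply_symm_apply] using hr (o.symm r)

end PosLogic

namespace PosLogic
variable {L : Lang.{u}}

/-! ### Selecting a row from a block -/

open Cardinal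

/-- The map on positions of an array that is given by `h r` on the row `r`. -/
def rowMap {R : Type*} (h : R → ℕ → ℕ) (q : R ×ₗ ℕ) : R ×ₗ ℕ :=
  toLex ((ofLex q).1, h (ofLex q).1 (ofLex q).2)

theorem rowMap_strictMono {R : Type*} [LinearOrder R] {h : R → ℕ → ℕ}
    (hh : ∀ r, StrictMono (h r)) : StrictMono (rowMap h) := by
  intro p q hpq
  rcases Prod.Lex.lt_iff.1 hpq with h₁ | ⟨h₁, h₂⟩
  · exact Prod.Lex.lt_iff.2 (.inl h₁)
  · exact Prod.Lex.lt_iff.2 (.inr ⟨h₁, by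
      change h _ _ < h _ _
      rw [← h₁]
      exact hh _ h₂⟩)

open Classical in
/-- The map on the positions of an array that is constant with value `m` on the row `r`. -/
noncomputable def collapse {R : Type*} (r : R) (m : ℕ) : R → ℕ → ℕ :=
  fun s t => if s = r then m else t

theorem collapse_self {R : Type*} (r : R) (m t : ℕ) : collapse r m r t = m := if_pos rfl

theorem collapse_of_ne {R : Type*} {r s : R} (h : s ≠ r) (m t : ℕ) : collapse r m s t = t :=
  if_neg h

theorem exists_strictMono_extend {N : ℕ} {j : Fin N → ℕ} (hj : StrictMono j) :
    ∃ j' : ℕ → ℕ, StrictMono j' ∧ ∀ i : Fin N, j' i = j i := by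
  -- The sum exceeds no less than every single value of `j`, so the continuation lies above all of
  -- them.
  refine ⟨fun t => if h : t < N then j ⟨t, h⟩ else t + ∑ i, j i + 1, fun t t' h => ?_, fun i => by
    simp⟩
  by_cases h' : t' < N
  · simp only [h', h.trans h', dite_true]
    exact hj h
  · by_cases h'' : t < N
    · have := Finset.single_le_sum (f := j) (fun i _ => Nat.zero_le _) (Finset.mem_univ ⟨t, h''⟩)
      simp only [h', h'', dite_true, dite_false]
      omega
    · simp only [h', h'', dite_false]
      omega

section

variable {U : Str L} {E : Set U.Elem} {α β : Type u} {σ : α → L.Sorts} {τ : β → L.Sorts}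
  {a : U.Tuple σ} {b : U.Tuple τ} {R : Type u} [LinearOrder R]

theorem mem_solutions_left {x : U.Tuple σ} {y : U.Tuple τ}
    (h : ∀ φ ∈ tp U (a.append b) E, x.append y ∈ φ.solutions) {χ : FormulaOver U E σ}
    (hχ : χ ∈ tp U a E) : x ∈ χ.solutions := by
  obtain ⟨φ, hφ⟩ := exists_solutions_comp (IsTermMap.var (M := U) (σ := Sum.elim σ τ) Sum.inl) χ
  exact (hφ _).1 (h φ ((hφ _).2 hχ))

theorem mem_solutions_right {x : U.Tuple σ} {y : U.Tuple τ}
    (h : ∀ φ ∈ tp U (a.append b) E, x.append y ∈ φ.solutions) {χ : FormulaOver U E τ}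
    (hχ : χ ∈ tp U b E) : y ∈ χ.solutions := by
  obtain ⟨φ, hφ⟩ := exists_solutions_comp (IsTermMap.var (M := U) (σ := Sum.elim σ τ) Sum.inr) χ
  exact (hφ _).1 (h φ ((hφ _).2 hχ))

namespace IndiscArray

variable (A : IndiscArray U E (a.append b) R)

/-- Some `x` is such that for any path through the rows in `C`, some `y` satisfies the type of
`(a, b)` together with `x`, the formulas of this path and the first ones of the rows in `D`. -/
def Selected (C D : Finset R) : Prop :=
  ∃ x : U.Tuple σ, ∀ f : R → ℕ, ∃ y : U.Tuple τ,
    (∀ φ ∈ tp U (a.append b) E, x.append y ∈ φ.solutions) ∧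
    (∀ s ∈ C, A.Φ s (x.append y) (A.z (toLex (s, f s)))) ∧
    ∀ s ∈ D, A.Φ s (x.append y) (A.z (toLex (s, 0)))

/-- One of the formulas that approximate `Selected`. -/
def Approx (φ : FormulaOver U E (Sum.elim σ τ)) (f : R → ℕ) (C D : Finset R)
    (x : U.Tuple σ) (v : R ×ₗ ℕ → U.Tuple A.ρ) (e : U.Tuple fun e : E => e.1.1) : Prop :=
  ∃ y : U.Tuple τ, Formula.Holds U φ ((x.append y).append e) ∧
    (∀ s ∈ C, A.Φ s (x.append y) (v (toLex (s, f s)))) ∧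
    ∀ s ∈ D, A.Φ s (x.append y) (v (toLex (s, 0)))

theorem isPos_approx (φ : FormulaOver U E (Sum.elim σ τ)) (f : R → ℕ) (C D : Finset R)
    {δ : Type*} {ς : δ → L.Sorts} {F : U.Tuple ς → U.Tuple σ}
    {V : R ×ₗ ℕ → U.Tuple ς → U.Tuple A.ρ} {G : U.Tuple ς → U.Tuple fun e : E => e.1.1}
    (hF : IsTermMap F) (hV : ∀ q, IsTermMap (V q)) (hG : IsTermMap G) :
    IsPos fun v => A.Approx φ f C D (F v) (fun q => V q v) (G v) := by
  have hl : IsTermMap (M := U) (σ := Sum.elim ς τ) (τ := ς) fun v a => v (.inl a) := .var Sum.inl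
  have hxy := (hF.comp hl).append (.var (M := U) (σ := Sum.elim ς τ) Sum.inr)
  refine IsPos.exists b (IsPos.and ?_ (IsPos.and ?_ ?_))
  · exact Formula.isPos_append φ hxy (hG.comp hl)
  · exact IsPos.forall_finset C fun s _ => (A.isPos s).comp₂ (P := A.Φ s) hxy ((hV _).comp hl)
  · exact IsPos.forall_finset D fun s _ => (A.isPos s).comp₂ (P := A.Φ s) hxy ((hV _).comp hl)

variable {A}

/-- Saturation is applied to `x` and again, for each path, to `y`. Finitely many conditions on `x`
reduce to one formula of the type and one bound `N` on the paths. -/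
theorem selected_of_approx [Finite R] {κ : Cardinal.{u}} (hU : U.IsSaturated κ) (h₀ : ℵ₀ < κ)
    (hE : #E < κ) (hα : #α < κ) (hβ : #β < κ) {C D : Finset R}
    (h : ∀ φ ∈ tp U (a.append b) E, ∀ N, ∃ x, ∀ f : R → ℕ, (∀ r, f r < N) →
      A.Approx φ f C D x A.z (U.enum E)) : A.Selected C D := by
  classical
  cases nonempty_fintype R
  have := A.finite
  let ς : ((R ×ₗ ℕ) × A.γ) ⊕ E → L.Sorts := Sum.elim (fun q => A.ρ q.2) fun e => e.1.1
  let c : U.Tuple ς := Str.Tuple.append (fun q : (R ×ₗ ℕ) × A.γ => A.z q.1 q.2) (U.enum E)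
  have hδ : #(((R ×ₗ ℕ) × A.γ) ⊕ E) < κ := by
    have : #(R ×ₗ ℕ) = #(R × ℕ) := mk_congr ofLex
    rw [mk_sum, mk_prod, lift_id, lift_id, lift_id, lift_id, this, mk_prod]
    refine add_lt_of_lt h₀.le (mul_lt_of_lt h₀.le (mul_lt_of_lt h₀.le ?_ ?_) ?_) hE
    · simpa using (lt_aleph0_of_finite R).trans h₀
    · simpa using h₀
    · exact (lt_aleph0_of_finite _).trans h₀
  obtain ⟨x, hx⟩ := hU.exists_forall hα hδ c (ι := tp U (a.append b) E × (R → ℕ))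
    (P := fun i x d => A.Approx i.1.1 i.2 C D x (fun q g => d (.inl (q, g))) fun e => d (.inr e))
    (fun i => A.isPos_approx _ _ _ _ (.var Sum.inl) (fun q => .var fun g => Sum.inr (Sum.inl (q, g)))
      (.var fun e => Sum.inr (Sum.inr e)))
    (fun s => by
      obtain ⟨φ, hφ, hall⟩ := tp_exists_and (a.append b) (s.image Prod.fst)
      obtain ⟨x, hx⟩ := h φ hφ (s.sup (fun i => Finset.univ.sup i.2) + 1)
      refine ⟨x, fun i hi => ?_⟩
      obtain ⟨y, hy, hy'⟩ := hx i.2 fun r => Nat.lt_succ_of_le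
        ((Finset.le_sup (Finset.mem_univ r)).trans
          (Finset.le_sup (f := fun i => Finset.univ.sup i.2) hi))
      exact ⟨y, hall _ hy _ (Finset.mem_image_of_mem _ hi), hy'⟩)
  refine ⟨x, fun f => ?_⟩
  obtain ⟨y, hy⟩ := hU.exists_forall hβ (δ := α ⊕ (((R ×ₗ ℕ) × A.γ) ⊕ E))
    (by rw [mk_sum, lift_id, lift_id]; exact add_lt_of_lt h₀.le hα hδ) (x.append c)
    (ι := tp U (a.append b) E)
    (P := fun i y d => Formula.Holds U i.1
        (Str.Tuple.append (Str.Tuple.append (fun a => d (.inl a)) y) fun e => d (.inr (.inr e))) ∧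
      (∀ s ∈ C, A.Φ s (Str.Tuple.append (fun a => d (.inl a)) y)
        fun g => d (.inr (.inl (toLex (s, f s), g)))) ∧
      ∀ s ∈ D, A.Φ s (Str.Tuple.append (fun a => d (.inl a)) y)
        fun g => d (.inr (.inl (toLex (s, 0), g))))
    (fun i => by
      have hxy := (IsTermMap.var (M := U) (σ := Sum.elim τ (Sum.elim σ ς))
        fun a => Sum.inr (Sum.inl a)).append (.var (M := U) (σ := Sum.elim τ (Sum.elim σ ς)) Sum.inl)
      refine IsPos.and ?_ (IsPos.and ?_ ?_)
      · exact Formula.isPos_append i.1 hxy (.var fun e => Sum.inr (Sum.inr (Sum.inr e)))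
      · exact IsPos.forall_finset C fun s _ => (A.isPos s).comp₂ (P := A.Φ s) hxy
          (.var fun g => Sum.inr (Sum.inr (Sum.inl (toLex (s, f s), g))))
      · exact IsPos.forall_finset D fun s _ => (A.isPos s).comp₂ (P := A.Φ s) hxy
          (.var fun g => Sum.inr (Sum.inr (Sum.inl (toLex (s, 0), g)))))
    (fun s => by
      obtain ⟨φ, hφ, hall⟩ := tp_exists_and (a.append b) s
      obtain ⟨y, hy, hy'⟩ := hx (⟨φ, hφ⟩, f)
      exact ⟨y, fun i hi => ⟨hall _ hy i hi, hy'⟩⟩)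
  exact ⟨y, fun φ hφ => (hy ⟨φ, hφ⟩).1, (hy ⟨.top, trivial⟩).2⟩

/-- If each row of a block fails to be selected, then the block gives an inp-pattern. -/
theorem selected_or_hasInpPattern [Finite R] {T : Theory L} {κ : Cardinal.{u}}
    (hU : IsMonster T κ U) (hE : #E < κ) (hα : #α < κ) (hβ : #β < κ) {C B D : Finset R}
    (hCB : Disjoint C B) (hBD : Disjoint B D) (h : A.Selected C (B ∪ D)) :
    (∃ r ∈ B, A.Selected (insert r C) D) ∨ HasInpPattern U (tp U a E) B.card := by
  classical
  refine or_iff_not_imp_left.2 fun hB => ?_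
  have hB : ∀ r : B, ∃ φ, φ ∈ tp U (a.append b) E ∧ ∃ N, ∀ x, ∃ f : R → ℕ, (∀ s, f s < N) ∧
      ¬ A.Approx φ f (insert r.1 C) D x A.z (U.enum E) := fun r => by
    by_contra! hcon
    exact hB ⟨r, r.2, selected_of_approx hU.saturated hU.aleph0_lt hE hα hβ fun φ hφ N =>
      hcon φ hφ N⟩
  choose φ hφ N hN using hB
  have hrC : ∀ r : B, ∀ s ∈ C, s ≠ r.1 := fun r s hs e =>
    Finset.disjoint_left.1 hCB hs (e ▸ r.2)
  have hrD : ∀ r : B, ∀ s ∈ D, s ≠ r.1 := fun r s hs e =>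
    Finset.disjoint_left.1 hBD (e ▸ r.2) hs
  -- `Q r` keeps row `r` at entry 0. The parameter `c r m` below is the whole array with row `r`
  -- collapsed to its entry `m`, so there `Q r` speaks of entry `m`.
  let Q : B → U.Tuple σ → (R ×ₗ ℕ → U.Tuple A.ρ) → U.Tuple (fun e : E => e.1.1) → Prop :=
    fun r x v e => ∀ f : R → Fin (N r), A.Approx (φ r) (fun s => f s) C (insert r.1 D) x v e
  let ς : ((R ×ₗ ℕ) × A.γ) ⊕ E → L.Sorts := Sum.elim (fun q => A.ρ q.2) fun e => e.1.1
  have hQ : ∀ r, IsPos fun v : U.Tuple (Sum.elim σ ς) => Q r (fun a => v (.inl a))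
      (fun q g => v (.inr (.inl (q, g)))) fun e => v (.inr (.inr e)) := fun r =>
    IsPos.forall_finite fun f => A.isPos_approx _ _ _ _ (.var Sum.inl)
      (fun q => .var fun g => Sum.inr (Sum.inl (q, g))) (.var fun e => Sum.inr (Sum.inr e))
  choose θ hθ using hQ
  let c : B → ℕ → U.Tuple ς := fun r m =>
    Str.Tuple.append (fun q : (R ×ₗ ℕ) × A.γ => A.z (rowMap (collapse r.1 m) q.1) q.2) (U.enum E)
  have hθc : ∀ r x m, (θ r).Holds U (x.append (c r m)) ↔
      Q r x (fun q => A.z (rowMap (collapse r.1 m) q)) (U.enum E) := fun r x m =>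
    hθ r (x.append (c r m))
  refine ⟨B, mk_coe_finset, ⟨⟨fun _ => _, fun _ => ς, c, θ, fun r => ?_, fun m => ?_⟩⟩⟩
  · have hrow : ¬ ∃ x : U.Tuple σ, ∀ i : Fin (N r), (θ r).Holds U (x.append fun d => c r i d) := by
      rintro ⟨x, hx⟩
      -- For the path `f` that fails at `x`, the parameter with index `f r` puts row `r` at the
      -- entry which `f` requires.
      obtain ⟨f, hf, hno⟩ := hN r x
      obtain ⟨y, hy, hyC, hyD⟩ := (hθc r x (f r)).1 (hx ⟨f r, hf r⟩) fun s => ⟨f s, hf s⟩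
      refine hno ⟨y, hy, fun s hs => ?_, fun s hs => ?_⟩
      · rcases Finset.mem_insert.1 hs with rfl | hs
        · simpa only [rowMap, ofLex_toLex, collapse_self] using
            hyD _ (Finset.mem_insert_self _ _)
        · simpa only [rowMap, ofLex_toLex, collapse_of_ne (hrC r s hs)] using hyC s hs
      · simpa only [rowMap, ofLex_toLex, collapse_of_ne (hrD r s hs)] using
          hyD s (Finset.mem_insert_of_mem hs)
    have hpos : IsPos fun V : U.Tuple fun p : Fin (N r) × (((R ×ₗ ℕ) × A.γ) ⊕ E) => ς p.2 =>
        ∃ x : U.Tuple σ, ∀ i, (θ r).Holds U (x.append fun d => V (i, d)) :=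
      IsPos.exists a (IsPos.forall_finite fun i =>
        Formula.isPos_append (θ r) (.var Sum.inr) (.var fun d => Sum.inl (i, d)))
    obtain ⟨Ψ, ⟨ψ, hψ⟩, hc, hd⟩ := hU.pec.exists_witness hpos (fun p => c r p.1 p.2) hrow
    refine ⟨N r, ψ, ?_, fun j hj => ?_⟩
    · rintro ⟨x, y, hy, hxy⟩
      exact hd _ ((hψ _).1 hy) ⟨x, hxy⟩
    -- Moving row `r` alone along `j'` takes `c r i` to `c r (j i)`, so indiscernibility carries `ψ`
    -- over.
    · obtain ⟨j', hj', hjj'⟩ := exists_strictMono_extend hj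
      have key := A.shift (fun v e => ψ.Holds U fun p => Str.Tuple.append
        (fun q : (R ×ₗ ℕ) × A.γ => v (rowMap (collapse r.1 p.1) q.1) q.2) e p.2)
        (ψ.isPos.comp (by
          rintro ⟨i, q | d⟩
          · exact ⟨.var (σ := ς) (.inl (rowMap (collapse r.1 i) q.1, q.2)), fun _ => rfl⟩
          · exact ⟨.var (σ := ς) (.inr d), fun _ => rfl⟩))
        (rowMap fun s t => if s = r.1 then j' t else t)
        (rowMap_strictMono fun s t t' ht => by by_cases hs : s = r.1 <;> simp [hs, hj' ht, ht])
        ((hψ _).2 hc)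
      convert key using 1
      funext p
      obtain ⟨i, q | d⟩ := p
      · have e : rowMap (collapse r.1 (j i)) q.1 =
            rowMap (fun s t => if s = r.1 then j' t else t) (rowMap (collapse r.1 i) q.1) := by
          by_cases hq : (ofLex q.1).1 = r.1 <;> simp [rowMap, collapse, hq, hjj']
        exact congrArg (fun p => A.z p q.2) e
      · rfl
  · refine consistent_tp_union a _ fun χ hχ => ?_
    -- By `h` one `x` satisfies every `Q r` with the rows of `B` at entry 0. Shifting each row `s`
    -- of `B` by `m s` yields the path `m`.
    obtain ⟨x, hx, hxQ⟩ := A.shift (fun v e => ∃ x : U.Tuple σ, Formula.Holds U χ (x.append e) ∧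
        ∀ r, Q r x v e)
      (IsPos.exists a (IsPos.and
        (Formula.isPos_append χ (.var Sum.inr) (.var fun d => Sum.inl (Sum.inr d)))
        (IsPos.forall_finite fun r => IsPos.forall_finite fun f => A.isPos_approx _ _ _ _
          (.var Sum.inr) (fun q => .var fun g => Sum.inl (Sum.inl (q, g)))
          (.var fun d => Sum.inl (Sum.inr d)))))
      (rowMap fun s t => if hs : s ∈ B then t + m ⟨s, hs⟩ else t)
      (rowMap_strictMono fun s t t' ht => by by_cases hs : s ∈ B <;> simp [hs, ht])
      (by
        obtain ⟨x, hx⟩ := h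
        obtain ⟨y, hy, -⟩ := hx fun _ => 0
        refine ⟨x, mem_solutions_left hy hχ, fun r f => ?_⟩
        obtain ⟨y, hy, hyC, hyD⟩ := hx fun s => f s
        refine ⟨y, hy _ (hφ r), hyC, fun s hs => hyD s ?_⟩
        rcases Finset.mem_insert.1 hs with rfl | hs
        · exact Finset.mem_union_left _ r.2
        · exact Finset.mem_union_right _ hs)
    refine ⟨x, hx, fun r => (hθc r x _).2 fun f => ?_⟩
    obtain ⟨y, hy, hyC, hyD⟩ := hxQ r f
    refine ⟨y, hy, fun s hs => ?_, fun s hs => ?_⟩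
    · have hsB : s ∉ B := Finset.disjoint_left.1 hCB hs
      simpa [rowMap, collapse_of_ne (hrC r s hs), hsB] using hyC s hs
    · rcases Finset.mem_insert.1 hs with rfl | hs
      · simpa [rowMap, collapse_self] using hyD _ (Finset.mem_insert_self _ _)
      · have hsB : s ∉ B := Finset.disjoint_right.1 hBD hs
        simpa [rowMap, collapse_of_ne (hrD r s hs), hsB] using
          hyD s (Finset.mem_insert_of_mem hs)

/-- `D` is consumed in `l` blocks of `k` rows, and each block contributes one row to `C`. -/
theorem exists_selected [Finite R] {T : Theory L} {κ : Cardinal.{u}}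
    (hU : IsMonster T κ U) (hE : #E < κ) (hα : #α < κ) (hβ : #β < κ) {k : ℕ}
    (hk : ¬ HasInpPattern U (tp U a E) k) (l : ℕ) {C D : Finset R} (hCD : Disjoint C D)
    (hD : D.card = k * l) (h : A.Selected C D) :
    ∃ C' : Finset R, C'.card = C.card + l ∧ A.Selected C' ∅ := by
  classical
  induction l generalizing C D with
  | zero =>
    obtain rfl : D = ∅ := by simpa using hD
    exact ⟨C, rfl, h⟩
  | succ l ih =>
    obtain ⟨B, hBD, hB⟩ := Finset.exists_subset_card_eq (s := D) (n := k) (by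
      rw [hD]; exact Nat.le_mul_of_pos_right k l.succ_pos)
    have hCB := hCD.mono_right hBD
    rcases selected_or_hasInpPattern (B := B) (D := D \ B) hU hE hα hβ hCB
      Finset.disjoint_sdiff (by rwa [Finset.union_sdiff_of_subset hBD]) with ⟨r, hr, hsel⟩ | hpat
    · obtain ⟨C', hC', hsel'⟩ := ih (C := insert r C) (D := D \ B)
        (Finset.disjoint_insert_left.2 ⟨fun h => (Finset.mem_sdiff.1 h).2 hr,
          hCD.mono_right Finset.sdiff_subset⟩)
        (by rw [Finset.card_sdiff_of_subset hBD, hB, hD, Nat.mul_succ, Nat.add_sub_cancel]) hsel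
      refine ⟨C', ?_, hsel'⟩
      rw [hC', Finset.card_insert_of_notMem fun h => Finset.disjoint_left.1 hCB h hr]
      omega
    · rw [hB] at hpat
      exact (hk hpat).elim

/-- The tuple `x` becomes a parameter in every entry. The formula for a row must exclude all
parameters that satisfy it, so it also says that the copies of `x` agree; this is positive because
only finitely many coordinates of `x` matter. -/
theorem Selected.hasInpPattern {C : Finset R} (h : A.Selected C ∅) :
    HasInpPattern U (tp U b E) C.card := by
  classical
  obtain ⟨x, hx⟩ := h
  have hpos : ∀ r : C, IsPos fun v : U.Tuple (Sum.elim τ (Sum.elim σ A.ρ)) =>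
      A.Φ r (Str.Tuple.append (fun a => v (.inr (.inl a))) fun b => v (.inl b))
        fun g => v (.inr (.inr g)) := fun r =>
    (A.isPos r).comp₂ (P := A.Φ r) (IsTermMap.append (.var fun a => Sum.inr (Sum.inl a))
      (.var Sum.inl)) (.var fun g => Sum.inr (Sum.inr g))
  choose θ hθ using hpos
  refine ⟨C, mk_coe_finset, ⟨⟨fun _ => α ⊕ A.γ, fun _ => Sum.elim σ A.ρ,
    fun r m => x.append (A.z (toLex (r.1, m))), θ, fun r => ?_, fun f => ?_⟩⟩⟩
  · obtain ⟨k, Ψ, hΨ, hd, hz⟩ := A.row r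
    obtain ⟨S, hS⟩ := (A.isPos r).exists_finset_congr
    obtain ⟨ψ, hψ⟩ : IsPos fun V : U.Tuple fun p : Fin k × (α ⊕ A.γ) => Sum.elim σ A.ρ p.2 =>
        (Ψ fun i g => V (i, .inr g)) ∧
        ∀ a ∈ S.preimage (fun a : α => .inl (.inl a))
          (Sum.inl_injective.comp Sum.inl_injective).injOn,
          ∀ p : Fin k × Fin k, V (p.1, .inl a) = V (p.2, .inl a) := by
      refine IsPos.and (hΨ.comp (IsTermMap.var (M := U)
        (σ := fun p : Fin k × (α ⊕ A.γ) => Sum.elim σ A.ρ p.2) fun q : Fin k × A.γ =>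
          (q.1, Sum.inr q.2))) (IsPos.forall_finset _ fun a _ => IsPos.forall_finite fun p =>
        IsPos.eq ⟨.var (σ := fun p : Fin k × (α ⊕ A.γ) => Sum.elim σ A.ρ p.2) (p.1, .inl a),
          fun _ => rfl⟩
        ⟨.var (σ := fun p : Fin k × (α ⊕ A.γ) => Sum.elim σ A.ρ p.2) (p.2, .inl a), fun _ => rfl⟩)
    refine ⟨k, ψ, ?_, fun j hj => (hψ _).2 ⟨hz j hj, fun _ _ _ => rfl⟩⟩
    rintro ⟨y, V, hV, hyV⟩
    obtain ⟨hV, hVe⟩ := (hψ _).1 hV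
    obtain ⟨x', hx'⟩ : ∃ x' : U.Tuple σ, ∀ i, ∀ a, .inl (.inl a) ∈ S → V i (.inl a) = x' a := by
      rcases Nat.eq_zero_or_pos k with rfl | hk
      · exact ⟨x, fun i => i.elim0⟩
      · exact ⟨fun a => V ⟨0, hk⟩ (.inl a), fun i a ha =>
          hVe a (Finset.mem_preimage.2 ha) (i, ⟨0, hk⟩)⟩
    refine hd ⟨x'.append y, fun i g => V i (.inr g), hV, fun i => ?_⟩
    refine (hS (Str.Tuple.append (Str.Tuple.append (fun a => V i (.inl a)) y)
      fun g => V i (.inr g)) (Str.Tuple.append (x'.append y) fun g => V i (.inr g)) ?_).1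
      ((hθ r (y.append (V i))).1 (hyV i))
    rintro ((a | b) | g) hS
    · exact hx' i a hS
    · rfl
    · rfl
  · refine consistent_tp_union b _ fun χ hχ => ?_
    obtain ⟨y, hy, hyC, -⟩ := hx fun r => if h : r ∈ C then f ⟨r, h⟩ else 0
    refine ⟨y, mem_solutions_right hy hχ, fun r => (hθ r _).2 ?_⟩
    have := hyC r r.2
    rw [dif_pos r.2] at this
    exact this

end IndiscArray

theorem hasInpPattern_append {T : Theory L} {κ : Cardinal.{u}} (hU : IsMonster T κ U)
    (hE : #E < κ) (hα : #α < κ) (hβ : #β < κ) {k l : ℕ}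
    (h : HasInpPattern U (tp U (a.append b) E) (k * l : ℕ)) :
    HasInpPattern U (tp U a E) k ∨ HasInpPattern U (tp U b E) l := by
  classical
  refine or_iff_not_imp_left.2 fun hk => ?_
  obtain ⟨R, hR, ⟨p⟩⟩ := h
  have : Finite R := lt_aleph0_iff_finite.1 (hR ▸ natCast_lt_aleph0)
  cases nonempty_fintype R
  let _ : LinearOrder R := LinearOrder.lift' (Fintype.equivFin R) (Fintype.equivFin R).injective
  obtain ⟨A⟩ := p.exists_indiscArray hU hE
  -- With no selected rows, the path of zeros suffices for every `f`.
  have hsel : A.Selected ∅ Finset.univ := by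
    refine IndiscArray.selected_of_approx hU.saturated hU.aleph0_lt hE hα hβ fun φ hφ N => ?_
    obtain ⟨x, hx, hr⟩ := A.path φ hφ fun _ => 0
    have e : x = Str.Tuple.append (fun a => x (.inl a)) fun b => x (.inr b) := by
      funext a
      rcases a with a | a <;> rfl
    rw [e] at hx hr
    exact ⟨fun a => x (.inl a), fun f _ => ⟨fun b => x (.inr b), hx, by simp, fun s _ => hr s⟩⟩
  obtain ⟨C, hC, hsel⟩ := IndiscArray.exists_selected hU hE hα hβ hk l
    (Finset.disjoint_empty_left _) (by
      rw [mk_fintype] at hR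
      exact_mod_cast hR) hsel
  rw [Finset.card_empty, zero_add] at hC
  exact hC ▸ hsel.hasInpPattern

end

end PosLogic

namespace PosLogic
variable {L : Lang.{u}}

/-! ### Burden -/

open Cardinal

section

variable {U : Str L} {E : Set U.Elem} {α β : Type u} {σ : α → L.Sorts} {τ : β → L.Sorts}

theorem HasInpPattern.mono {π : Set (FormulaOver U E σ)} {μ ν : Cardinal.{u}} (hμ : μ ≤ ν)
    (h : HasInpPattern U π ν) : HasInpPattern U π μ := by
  classical
  obtain ⟨R, rfl, ⟨p⟩⟩ := h
  obtain ⟨S, rfl⟩ := le_mk_iff_exists_set.1 hμ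
  refine ⟨S, rfl, ⟨⟨fun r => p.β r, fun r => p.τ r, fun r => p.a r, fun r => p.φ r,
    fun r => p.row r, fun f F hF hsub => ?_⟩⟩⟩
  refine p.path (fun r => if h : r ∈ S then f ⟨r, h⟩ else 0) F hF (hsub.trans ?_)
  refine Set.union_subset_union_right _ ?_
  rintro _ ⟨r, rfl⟩
  refine ⟨r, ?_⟩
  simp only [Subtype.coe_prop, dite_true]

theorem hasInpPattern_zero (a : U.Tuple σ) : HasInpPattern U (tp U a E) 0 := by
  refine ⟨PEmpty, mk_pempty, ⟨⟨fun r => r.elim, fun r => r.elim, fun r => r.elim, fun r => r.elim,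
    fun r => r.elim, fun f => ?_⟩⟩⟩
  exact consistent_tp_union a _ fun φ hφ => ⟨a, hφ, fun r => r.elim⟩

theorem bdn_lt_natCast_iff {κ : Cardinal.{u}} (h₀ : ℵ₀ < κ) (a : U.Tuple σ) (k : ℕ) :
    bdn U κ a E < ((k : Cardinal.{u}) : WithTop Cardinal.{u}) ↔
      ¬ HasInpPattern U (tp U a E) k := by
  have hk : (k : Cardinal.{u}) < κ := natCast_lt_aleph0.trans h₀
  unfold bdn burden
  constructor
  · intro h hp
    split_ifs at h with hb
    · rw [WithTop.coe_lt_coe] at h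
      obtain ⟨μ, -, hμ⟩ := hb
      exact h.not_ge (le_csSup ⟨μ, fun ν hν => hμ ν hν⟩ ⟨hk, hp⟩)
    · exact not_top_lt h
  · intro hp
    have hlt : ∀ ν ∈ depths U κ (tp U a E), ν < k := fun ν hν => by
      by_contra h
      exact hp (hν.2.mono (not_lt.1 h))
    rw [if_pos ⟨k, hk, fun ν hν => (hlt ν hν).le⟩, WithTop.coe_lt_coe]
    -- The empty pattern excludes `k = 0`. For `k + 1` all depths are natural numbers at most `k`,
    -- so the supremum stays strictly below.
    obtain _ | k := k
    · exact (hp (by simpa using hasInpPattern_zero a)).elim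
    · refine (csSup_le' (a := (k : Cardinal.{u})) fun ν hν => ?_).trans_lt
        (by exact_mod_cast k.lt_succ_self)
      have := hlt ν hν
      obtain ⟨m, rfl⟩ := lt_aleph0.1 (this.trans natCast_lt_aleph0)
      exact_mod_cast Nat.lt_succ_iff.1 (by exact_mod_cast this)

/-- Transport of inp-patterns along an invertible change of variables. -/
theorem HasInpPattern.map {F : U.Tuple σ → U.Tuple τ} {G : U.Tuple τ → U.Tuple σ}
    (hF : IsTermMap F) (hG : IsTermMap G) (hGF : ∀ x, G (F x) = x) {a : U.Tuple σ}
    {k : ℕ} (h : HasInpPattern U (tp U a E) k) : HasInpPattern U (tp U (F a) E) k := by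
  obtain ⟨R, hR, ⟨p⟩⟩ := h
  have : Finite R := lt_aleph0_iff_finite.1 (hR ▸ natCast_lt_aleph0)
  have hφ : ∀ r, IsPos fun v : U.Tuple (Sum.elim τ (p.τ r)) =>
      (p.φ r).Holds U (Str.Tuple.append (G fun b => v (.inl b)) fun c => v (.inr c)) := fun r =>
    Formula.isPos_append (p.φ r) (hG.comp (.var Sum.inl)) (.var Sum.inr)
  choose φ hφ using hφ
  refine ⟨R, hR, ⟨⟨p.β, p.τ, p.a, φ, fun r => ?_, fun f => ?_⟩⟩⟩
  · obtain ⟨k, ψ, hd, hψ⟩ := p.row r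
    refine ⟨k, ψ, ?_, hψ⟩
    rintro ⟨x, y, hy, hxy⟩
    exact hd ⟨G x, y, hy, fun i => (hφ r _).1 (hxy i)⟩
  · refine consistent_tp_union (F a) _ fun χ hχ => ?_
    obtain ⟨χ', hχ'⟩ := exists_solutions_comp hF χ
    obtain ⟨x, hx, hr⟩ := (p.path f).exists_mem (φ := χ') ((hχ' a).2 hχ)
    refine ⟨F x, (hχ' x).1 hx, fun r => (hφ r _).2 ?_⟩
    change (p.φ r).Holds U (Str.Tuple.append (G (F x)) (p.a r (f r)))
    rw [hGF]
    exact hr r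

/-- The base case, an empty product: the only tuple in no variables would satisfy the formula of a
row at all its entries. -/
theorem not_hasInpPattern_one [IsEmpty α] (a : U.Tuple σ) :
    ¬ HasInpPattern U (tp U a E) 1 := by
  rintro ⟨R, hR, ⟨p⟩⟩
  obtain ⟨r⟩ := (mk_ne_zero_iff (α := R)).1 (hR ▸ one_ne_zero)
  have h : ∀ m, (p.φ r).Holds U (a.append (p.a r m)) := fun m => by
    obtain ⟨x, hx⟩ := p.path (fun _ => m) {{x | (p.φ r).Holds U (x.append (p.a r m))}}
      (Set.finite_singleton _) (Set.singleton_subset_iff.2 (.inr ⟨r, rfl⟩))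
    have hx : (p.φ r).Holds U (x.append (p.a r m)) := hx _ rfl
    rwa [show x = a from funext fun i => isEmptyElim i] at hx
  obtain ⟨k, ψ, hd, hψ⟩ := p.row r
  exact hd ⟨a, fun i => p.a r i, hψ Fin.val Fin.val_strictMono, fun i => h i⟩

end

/-! ### Concatenations of finitely many tuples -/

theorem mk_sigma_fin_lt {κ : Cardinal.{u}} (h₀ : ℵ₀ < κ) (n : ℕ) (ι : Fin n → Type u)
    (hι : ∀ i, #(ι i) < κ) : #(Σ i, ι i) < κ := by
  induction n with
  | zero => exact (mk_eq_zero (Σ i, ι i)).trans_lt (aleph0_pos.trans h₀)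
  | succ n ih =>
    refine (mk_le_of_surjective (α := ι 0 ⊕ Σ i : Fin n, ι i.succ)
      (f := Sum.elim (fun x => ⟨0, x⟩) fun p => ⟨p.1.succ, p.2⟩) ?_).trans_lt ?_
    · rintro ⟨i, x⟩
      induction i using Fin.cases with
      | zero => exact ⟨.inl x, rfl⟩
      | succ i => exact ⟨.inr ⟨i, x⟩, rfl⟩
    · rw [mk_sum, lift_id, lift_id]
      exact add_lt_of_lt h₀.le (hι 0) (ih (fun i => ι i.succ) fun i => hι _)

theorem not_hasInpPattern_prod {T : Theory L} {κ : Cardinal.{u}} {U : Str L}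
    (hU : IsMonster T κ U) {E : Set U.Elem} (hE : #E < κ) (n : ℕ) (ι : Fin n → Type u)
    (hι : ∀ i, #(ι i) < κ) (σ : ∀ i, ι i → L.Sorts) (a : ∀ i, U.Tuple (σ i)) (k : Fin n → ℕ)
    (h : ∀ i, ¬ HasInpPattern U (tp U (a i) E) (k i)) :
    ¬ HasInpPattern U (tp U (σ := fun p : (Σ i, ι i) => σ p.1 p.2) (fun p => a p.1 p.2) E)
      ((∏ i, k i : ℕ) : Cardinal.{u}) := by
  induction n with
  | zero =>
    have key := not_hasInpPattern_one (U := U) (E := E)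
      (σ := fun p : (Σ i, ι i) => σ p.1 p.2) (fun p => a p.1 p.2)
    simpa using key
  | succ n ih =>
    intro hp
    -- `F` and `G` identify the whole tuple with its first block followed by the rest, the shape
    -- required for two tuples.
    let F : U.Tuple (fun p : (Σ i, ι i) => σ p.1 p.2) →
        U.Tuple (Sum.elim (σ 0) fun p : (Σ i : Fin n, ι i.succ) => σ p.1.succ p.2) := fun v =>
      Str.Tuple.append (fun x => v ⟨0, x⟩) fun p => v ⟨p.1.succ, p.2⟩
    let G : U.Tuple (Sum.elim (σ 0) fun p : (Σ i : Fin n, ι i.succ) => σ p.1.succ p.2) →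
        U.Tuple (fun p : (Σ i, ι i) => σ p.1 p.2) := fun v p =>
      Fin.cases (motive := fun i => ∀ x : ι i, U.carrier (σ i x)) (fun x => v (.inl x))
        (fun i x => v (.inr ⟨i, x⟩)) p.1 p.2
    have hF : IsTermMap F :=
      .append (.var (α := Σ i, ι i) (β := ι 0) fun x => ⟨0, x⟩)
        (.var (α := Σ i, ι i) (β := Σ i : Fin n, ι i.succ) fun p => ⟨p.1.succ, p.2⟩)
    have hG : IsTermMap G := by
      rintro ⟨i, x⟩
      induction i using Fin.cases with
      | zero => exact ⟨.var (σ := Sum.elim (σ 0) fun p : (Σ i : Fin n, ι i.succ) =>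
          σ p.1.succ p.2) (.inl x), fun _ => rfl⟩
      | succ i => exact ⟨.var (σ := Sum.elim (σ 0) fun p : (Σ i : Fin n, ι i.succ) =>
          σ p.1.succ p.2) (.inr ⟨i, x⟩), fun _ => rfl⟩
    have hGF : ∀ v, G (F v) = v := fun v => by
      funext ⟨i, x⟩
      induction i using Fin.cases <;> rfl
    have hp' := hp.map hF hG hGF
    rw [Fin.prod_univ_succ] at hp'
    rcases hasInpPattern_append (a := a 0)
      (b := fun p : (Σ i : Fin n, ι i.succ) => a p.1.succ p.2) hU hE (hι 0)
      (mk_sigma_fin_lt hU.aleph0_lt n _ fun i => hι i.succ) hp' with h₁ | h₂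
    · exact h 0 h₁
    · exact ih (fun i => ι i.succ) (fun i => hι _) (fun i => σ i.succ) (fun i => a i.succ)
        (fun i => k i.succ) (fun i => h _) h₂

end PosLogic

theorem mainTheorem8 {L : PosLogic.Lang.{u}} (T : PosLogic.Theory L) (κ : Cardinal.{u})
    (U : PosLogic.Str L) (hU : PosLogic.IsMonster T κ U)
    (E : Set U.Elem) (hE : Cardinal.mk E < κ)
    (n : ℕ) (ι : Fin n → Type u) (hι : ∀ i, Cardinal.mk (ι i) < κ)
    (σ : ∀ i, ι i → L.Sorts) (a : ∀ i, U.Tuple (σ i)) (k : Fin n → ℕ)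
    (h : ∀ i, PosLogic.bdn U κ (a i) E < ((k i : Cardinal.{u}) : WithTop Cardinal.{u})) :
    PosLogic.bdn U κ (σ := fun p : (Σ i, ι i) => σ p.1 p.2) (fun p => a p.1 p.2) E <
      (((∏ i, k i : ℕ) : Cardinal.{u}) : WithTop Cardinal.{u}) := by
  rw [PosLogic.bdn_lt_natCast_iff hU.aleph0_lt]
  exact PosLogic.not_hasInpPattern_prod hU hE n ι hι σ a k fun i =>
    (PosLogic.bdn_lt_natCast_iff hU.aleph0_lt _ _).1 (h i)
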